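/- **Theorem.** There is a universal constant $c>0$ such that for all $n,t\in\mathbb{N}$, with $d=2^n$, the $n$-qubit $PFC$ ensemble is a diamond $\epsilon$-approximate $t$-design with $\epsilon = c\,t/\sqrt{d}$. Here the $n$-qubit $PFC$ ensemble is the law of the random unitary $PFC\in \mathrm{U}(d)$, where $P:|x\rangle\mapsto|\pi(x)\rangle$ for a uniformly random permutation $\pi$ of $\{0,1\}^n$, $F:|x\rangle\mapsto(-1)^{f(x)}|x\rangle$ for a uniformly random function $f:\{0,1\}^n\to\{0,1\}$, and $C$ is a uniformly random element of the $n$-qubit Clifford group (the normalizer in $\mathrm{U}(d)$ of the Pauli group; "uniformly random" means distributed by the invariant probability measure of this compact group, which is uniform on the finite quotient by global phases), and $P$, $F$, $C$ are independent. A probability distribution $\nu$ on $\mathrm{U}(d)$ is a diamond $\epsilon$-approximate $t$-design if $\|\mathcal{M}^{(t)}_\nu-\mathcal{M}^{(t)}_{\mathrm{Haar}}\|_\Diamond\le\epsilon$, where $\mathcal{M}^{(t)}_\nu(X)=\mathbb{E}_{U\sim\nu}\,U^{\otimes t}X\,(U^{\otimes t})^\dagger$ is the $t$-wise twirl, $\mathrm{Haar}$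 is the Haar probability measure on $\mathrm{U}(d)$, and, for channels $\mathcal{M},\mathcal{N}$ on $\mathrm{L}(\mathcal{H})$, $\|\mathcal{M}-\mathcal{N}\|_\Diamond=\sup_{|\psi\rangle}\|(\mathcal{M}\otimes\mathrm{id}_{\mathcal{H}})(|\psi\rangle\langle\psi|)-(\mathcal{N}\otimes\mathrm{id}_{\mathcal{H}})(|\psi\rangle\langle\psi|)\|_1$, the supremum being over unit vectors $|\psi\rangle\in\mathcal{H}\otimes\mathcal{H}$ and $\|A\|_1=\mathrm{Tr}[(A^\dagger A)^{1/2}]$. -/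

import Mathlib

open MeasureTheory
open scoped Matrix

noncomputable section

namespace PFC

/-! ### Trace norm, superoperators and the diamond distance -/

/-- The Schatten 1-norm `Tr[(A† A)^{1/2}]`; the square root is taken in the functional calculus
of the Hermitian matrix `A† A`. -/
def traceNorm {κ : Type*} [Fintype κ] [DecidableEq κ] (A : Matrix κ κ ℂ) : ℝ :=
  (cfc Real.sqrt (Aᴴ * A)).trace.re

/-- Superoperators `L(ℂ^κ) → L(ℂ^μ)`, in the standard bases. -/
abbrev Superop (κ μ : Type*) := Matrix κ κ ℂ →ₗ[ℂ] Matrix μ μ ℂ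

/-- `M ⊗ id_R`: the superoperator `M` is applied to each `R`-block of the argument. -/
def Superop.tensorId {κ μ : Type*} (M : Superop κ μ) (R : Type*) : Superop (κ × R) (μ × R) where
  toFun X := Matrix.of fun p q => M (Matrix.of fun a b => X (a, p.2) (b, q.2)) p.1 q.1
  map_add' X Y := by
    ext p q
    exact congrFun (congrFun (M.map_add (Matrix.of fun a b => X (a, p.2) (b, q.2))
      (Matrix.of fun a b => Y (a, p.2) (b, q.2))) p.1) q.1
  map_smul' c X := by
    ext p q
    exact congrFun (congrFun (M.map_smul c (Matrix.of fun a b => X (a, p.2) (b, q.2))) p.1) q.1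

/-- The rank-one operator `|ψ⟩⟨ψ|`. -/
def proj {κ : Type*} (ψ : EuclideanSpace ℂ κ) : Matrix κ κ ℂ :=
  Matrix.of fun a b => ψ a * star (ψ b)

/-- The diamond distance: the supremum, over all pure states `ψ` of the input system and an
ancilla of the same dimension, of `‖(M ⊗ id)(|ψ⟩⟨ψ|) - (N ⊗ id)(|ψ⟩⟨ψ|)‖₁`. It is taken in the
extended reals, so that no boundedness convention is involved. -/
def diamondDist {κ μ : Type*} [Fintype κ] [Fintype μ] [DecidableEq κ] [DecidableEq μ]
    (M N : Superop κ μ) : EReal :=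
  ⨆ ψ : {ψ : EuclideanSpace ℂ (κ × κ) // ‖ψ‖ = 1},
    ((traceNorm (M.tensorId κ (proj ψ.1) - N.tensorId κ (proj ψ.1)) : ℝ) : EReal)

/-! ### The unitary group as a compact group with its Borel σ-algebra -/

section Unitary

variable {ι : Type*} [Fintype ι] [DecidableEq ι]

instance : MeasurableSpace (Matrix.unitaryGroup ι ℂ) := borel _

instance : BorelSpace (Matrix.unitaryGroup ι ℂ) := ⟨rfl⟩

instance : SecondCountableTopology (Matrix ι ι ℂ) :=
  inferInstanceAs (SecondCountableTopology (ι → ι → ℂ))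

instance : SecondCountableTopology (Matrix.unitaryGroup ι ℂ) :=
  inferInstanceAs (SecondCountableTopology
    {U : Matrix ι ι ℂ // U ∈ (Matrix.unitaryGroup ι ℂ : Set (Matrix ι ι ℂ))})

instance : T2Space (Matrix ι ι ℂ) := inferInstanceAs (T2Space (ι → ι → ℂ))

instance : CompactSpace (Matrix.unitaryGroup ι ℂ) := by
  have hK : IsCompact (Set.univ.pi fun _ : ι => Set.univ.pi fun _ : ι =>
      Metric.closedBall (0 : ℂ) 1) :=
    isCompact_univ_pi fun _ => isCompact_univ_pi fun _ => isCompact_closedBall _ _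
  have hc : IsClosed {U : Matrix ι ι ℂ | U * star U = 1} :=
    isClosed_eq (continuous_id.mul continuous_star) continuous_const
  have hset : (Matrix.unitaryGroup ι ℂ : Set (Matrix ι ι ℂ)) = {U | U * star U = 1} := by
    ext U
    exact Matrix.mem_unitaryGroup_iff
  refine isCompact_iff_compactSpace.mp (hK.of_isClosed_subset (hset ▸ hc) ?_)
  intro U hU i _ j _
  simpa using entry_norm_bound_of_unitary hU i j

end Unitary

/-- The invariant (Haar) probability measure of a compact group. -/
def haarProb (G : Type*) [Group G] [TopologicalSpace G] [IsTopologicalGroup G] [CompactSpace G]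
    [MeasurableSpace G] [BorelSpace G] : ProbabilityMeasure G :=
  ⟨Measure.haarMeasure ⊤, ⟨by
    simpa using Measure.haarMeasure_self (K₀ := (⊤ : TopologicalSpace.PositiveCompacts G))⟩⟩

/-! ### Ensembles of unitaries, twirls and approximate designs -/

section Design

variable {ι : Type*} [Fintype ι] [DecidableEq ι]

/-- The `t`-fold tensor power `U^{⊗t}` as a matrix in the product basis of `(ℂ^ι)^{⊗t}`. -/
def tensorPow (t : ℕ) (U : Matrix ι ι ℂ) : Matrix (Fin t → ι) (Fin t → ι) ℂ :=
  Matrix.of fun a b => ∏ k, U (a k) (b k)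

theorem integrable_twirl (ν : ProbabilityMeasure (Matrix.unitaryGroup ι ℂ)) (t : ℕ)
    (X : Matrix (Fin t → ι) (Fin t → ι) ℂ) (a b : Fin t → ι) :
    Integrable (fun U : Matrix.unitaryGroup ι ℂ =>
      (tensorPow t U.1 * X * (tensorPow t U.1)ᴴ) a b) (ν : Measure _) := by
  have hT : Continuous fun U : Matrix.unitaryGroup ι ℂ => tensorPow t U.1 := by
    refine continuous_matrix fun i j => ?_
    simp only [tensorPow, Matrix.of_apply]
    exact continuous_finsetProd _ fun k _ => continuous_subtype_val.matrix_elem (i k) (j k)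
  have hc : Continuous fun U : Matrix.unitaryGroup ι ℂ =>
      (tensorPow t U.1 * X * (tensorPow t U.1)ᴴ) a b :=
    ((hT.matrix_mul continuous_const).matrix_mul hT.matrix_conjTranspose).matrix_elem a b
  exact hc.integrable_of_hasCompactSupport (HasCompactSupport.of_compactSpace _)

/-- The `t`-wise twirl `X ↦ 𝔼_{U ∼ ν} U^{⊗t} X (U^{⊗t})†`, the expectation being taken
entrywise. -/
def twirl (ν : ProbabilityMeasure (Matrix.unitaryGroup ι ℂ)) (t : ℕ) :
    Superop (Fin t → ι) (Fin t → ι) where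
  toFun X := Matrix.of fun a b =>
    ∫ U : Matrix.unitaryGroup ι ℂ, (tensorPow t U.1 * X * (tensorPow t U.1)ᴴ) a b ∂(ν : Measure _)
  map_add' X Y := by
    ext a b
    simp only [Matrix.of_apply, Matrix.add_apply, Matrix.mul_add, Matrix.add_mul]
    exact integral_add (integrable_twirl ν t X a b) (integrable_twirl ν t Y a b)
  map_smul' c X := by
    ext a b
    simp only [Matrix.of_apply, Matrix.smul_apply, Matrix.mul_smul, Matrix.smul_mul,
      RingHom.id_apply]
    exact integral_smul c _

/-- `ν` is a diamond `ε`-approximate `t`-design: its `t`-wise twirl is within diamond distance `ε`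
of the `t`-wise twirl of the Haar measure on the unitary group. -/
def IsDiamondApproxDesign (ν : ProbabilityMeasure (Matrix.unitaryGroup ι ℂ)) (ε : ℝ) (t : ℕ) :
    Prop :=
  diamondDist (twirl ν t) (twirl (haarProb (Matrix.unitaryGroup ι ℂ)) t) ≤ (ε : EReal)

end Design

/-! ### The PFC ensemble -/

/-- Labels of the computational basis of `n` qubits. -/
abbrev Bits (n : ℕ) := Fin n → Fin 2

/-- The unitary group `U(2^n)` on `n` qubits. -/
abbrev QU (n : ℕ) := Matrix.unitaryGroup (Bits n) ℂ

/-- The permutation operator `|x⟩ ↦ |π x⟩`. -/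
def permUnitary {n : ℕ} (π : Equiv.Perm (Bits n)) : QU n :=
  ⟨Matrix.of fun y x => if y = π x then 1 else 0, by
    rw [Matrix.mem_unitaryGroup_iff']
    ext x y
    simp [Matrix.mul_apply, Matrix.one_apply, Matrix.star_apply, eq_comm]⟩

/-- The binary phase operator `|x⟩ ↦ (-1)^{f x} |x⟩`. -/
def phaseUnitary {n : ℕ} (f : Bits n → Fin 2) : QU n :=
  ⟨Matrix.diagonal fun x => (-1 : ℂ) ^ (f x : ℕ), by
    rw [Matrix.mem_unitaryGroup_iff', Matrix.star_eq_conjTranspose, Matrix.diagonal_conjTranspose,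
      Matrix.diagonal_mul_diagonal, ← Matrix.diagonal_one]
    congr 1
    funext x
    simp [← mul_pow]⟩

/-- The single-qubit Pauli matrices `1, X, Y, Z`. -/
def pauli : Fin 4 → Matrix (Fin 2) (Fin 2) ℂ :=
  ![1, !![0, 1; 1, 0], !![0, -Complex.I; Complex.I, 0], !![1, 0; 0, -1]]

/-- The Pauli string `σ_{p 0} ⊗ ⋯ ⊗ σ_{p (n-1)}`. -/
def pauliString {n : ℕ} (p : Fin n → Fin 4) : Matrix (Bits n) (Bits n) ℂ :=
  Matrix.of fun x y => ∏ k, pauli (p k) (x k) (y k)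

theorem pauli_mul (a b : Fin 4) :
    ∃ (k : ℕ) (c : Fin 4), pauli a * pauli b = Complex.I ^ k • pauli c := by
  have hI : Complex.I ^ 3 = -Complex.I := Complex.I_pow_three
  fin_cases a <;> fin_cases b
  · exact ⟨0, 0, by simp [pauli]⟩
  · exact ⟨0, 1, by simp [pauli]⟩
  · exact ⟨0, 2, by simp [pauli]⟩
  · exact ⟨0, 3, by simp [pauli]⟩
  · exact ⟨0, 1, by simp [pauli]⟩
  · exact ⟨0, 0, by simp [pauli, Matrix.one_fin_two]⟩
  · exact ⟨1, 3, by simp [pauli]⟩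
  · exact ⟨3, 2, by simp [pauli, hI]⟩
  · exact ⟨0, 2, by simp [pauli]⟩
  · exact ⟨3, 3, by simp [pauli, hI]⟩
  · exact ⟨0, 0, by simp [pauli, Matrix.one_fin_two]⟩
  · exact ⟨1, 1, by simp [pauli]⟩
  · exact ⟨0, 3, by simp [pauli]⟩
  · exact ⟨1, 2, by simp [pauli]⟩
  · exact ⟨3, 1, by simp [pauli, hI]⟩
  · exact ⟨0, 0, by simp [pauli, Matrix.one_fin_two]⟩

theorem pauli_conjTranspose (a : Fin 4) : (pauli a)ᴴ = pauli a := by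
  fin_cases a <;> ext i j <;> fin_cases i <;> fin_cases j <;> simp [pauli]

theorem pauliString_mul {n : ℕ} (p q : Fin n → Fin 4) :
    ∃ (k : ℕ) (r : Fin n → Fin 4),
      pauliString p * pauliString q = Complex.I ^ k • pauliString r := by
  choose k r h using fun i => pauli_mul (p i) (q i)
  refine ⟨∑ i, k i, r, ?_⟩
  ext x y
  have h' : ∀ i, ∑ z, pauli (p i) (x i) z * pauli (q i) z (y i) =
      Complex.I ^ k i * pauli (r i) (x i) (y i) := fun i => by
    simpa [Matrix.mul_apply] using congrFun (congrFun (h i) (x i)) (y i)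
  simp only [pauliString, Matrix.mul_apply, Matrix.of_apply, Matrix.smul_apply, smul_eq_mul,
    ← Finset.prod_mul_distrib, ← Finset.prod_pow_eq_pow_sum, ← h']
  exact (Finset.prod_univ_sum (fun _ => Finset.univ)
    (fun i z => pauli (p i) (x i) z * pauli (q i) z (y i))).symm

theorem pauliString_conjTranspose {n : ℕ} (p : Fin n → Fin 4) :
    (pauliString p)ᴴ = pauliString p := by
  ext x y
  have h : ∀ i, star (pauli (p i) (y i) (x i)) = pauli (p i) (x i) (y i) := fun i =>
    congrFun (congrFun (pauli_conjTranspose (p i)) (x i)) (y i)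
  simp only [pauliString, Matrix.conjTranspose_apply, Matrix.of_apply, star_prod, h]

theorem pauliString_zero (n : ℕ) : pauliString (0 : Fin n → Fin 4) = 1 := by
  ext x y
  simp [pauliString, pauli, Matrix.one_apply, Finset.prod_ite_zero, funext_iff]

/-- The `n`-qubit Pauli group: all `i^k σ_{p 0} ⊗ ⋯ ⊗ σ_{p (n-1)}`. -/
def pauliGroup (n : ℕ) : Subgroup (QU n) where
  carrier := {U | ∃ (k : ℕ) (p : Fin n → Fin 4), U.1 = Complex.I ^ k • pauliString p}
  one_mem' := ⟨0, 0, by simp [pauliString_zero]⟩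
  mul_mem' := by
    rintro U V ⟨k, p, hU⟩ ⟨l, q, hV⟩
    obtain ⟨m, r, h⟩ := pauliString_mul p q
    refine ⟨k + l + m, r, ?_⟩
    change U.1 * V.1 = _
    rw [hU, hV, Matrix.smul_mul, Matrix.mul_smul, h, smul_smul, smul_smul, pow_add, pow_add,
      mul_assoc]
  inv_mem' := by
    rintro U ⟨k, p, hU⟩
    refine ⟨3 * k, p, ?_⟩
    change star U.1 = _
    rw [hU, Matrix.star_eq_conjTranspose, Matrix.conjTranspose_smul, pauliString_conjTranspose,
      star_pow, pow_mul, Complex.I_pow_three]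
    simp

/-- The `n`-qubit Clifford group: the unitaries that normalize the Pauli group. It contains all
global phases. -/
def cliffordGroup (n : ℕ) : Subgroup (QU n) := Subgroup.normalizer (pauliGroup n : Set (QU n))

theorem pauliGroup_finite (n : ℕ) : (pauliGroup n : Set (QU n)).Finite := by
  refine Set.Finite.of_finite_image (f := Subtype.val) ?_ Subtype.val_injective.injOn
  refine (Set.finite_range fun kp : Fin 4 × (Fin n → Fin 4) =>
    Complex.I ^ (kp.1 : ℕ) • pauliString kp.2).subset ?_
  rintro _ ⟨U, ⟨k, p, hU⟩, rfl⟩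
  refine ⟨(⟨k % 4, Nat.mod_lt _ (by norm_num)⟩, p), ?_⟩
  rw [hU]
  simp [← Complex.I_pow_eq_pow_mod]

theorem cliffordGroup_isClosed (n : ℕ) : IsClosed (cliffordGroup n : Set (QU n)) := by
  have hcl : IsClosed (pauliGroup n : Set (QU n)) := (pauliGroup_finite n).isClosed
  have : (cliffordGroup n : Set (QU n)) =
      ⋂ V ∈ (pauliGroup n : Set (QU n)),
        ((fun U : QU n => U * V * U⁻¹) ⁻¹' (pauliGroup n : Set (QU n)) ∩
          (fun U : QU n => U⁻¹ * V * U) ⁻¹' (pauliGroup n : Set (QU n))) := by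
    ext U
    simp only [cliffordGroup, SetLike.mem_coe, Subgroup.mem_normalizer_iff, Set.mem_iInter,
      Set.mem_inter_iff, Set.mem_preimage]
    constructor
    · intro h V hV
      refine ⟨(h V).1 hV, (h _).2 ?_⟩
      simpa [mul_assoc] using hV
    · intro h V
      refine ⟨fun hV => (h V hV).1, fun hV => ?_⟩
      simpa [mul_assoc] using (h _ hV).2
  rw [this]
  refine isClosed_biInter fun V _ => IsClosed.inter ?_ ?_
  · exact hcl.preimage ((continuous_id.mul continuous_const).mul continuous_inv)
  · exact hcl.preimage ((continuous_inv.mul continuous_const).mul continuous_id)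

instance (n : ℕ) : CompactSpace (cliffordGroup n) :=
  isCompact_iff_compactSpace.mp (cliffordGroup_isClosed n).isCompact

/-- A uniformly random permutation operator `P`. -/
def permEnsemble (n : ℕ) : ProbabilityMeasure (QU n) :=
  ⟨((PMF.uniformOfFintype (Equiv.Perm (Bits n))).map permUnitary).toMeasure, inferInstance⟩

/-- A uniformly random binary phase operator `F`. -/
def phaseEnsemble (n : ℕ) : ProbabilityMeasure (QU n) :=
  ⟨((PMF.uniformOfFintype (Bits n → Fin 2)).map phaseUnitary).toMeasure, inferInstance⟩

/-- A uniformly random Clifford unitary `C`: the law of a Haar random element of the (compact)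
Clifford group. Modulo global phases the Clifford group is finite, and this measure gives all
its elements the same weight. -/
def cliffordEnsemble (n : ℕ) : ProbabilityMeasure (QU n) :=
  (haarProb (cliffordGroup n)).map (f := Subtype.val) measurable_subtype_coe.aemeasurable

/-- The PFC ensemble: the law of the product `P F C` of independent `P`, `F` and `C`. -/
def pfcEnsemble (n : ℕ) : ProbabilityMeasure (QU n) :=
  ⟨(permEnsemble n : Measure (QU n)) ∗ₘ (phaseEnsemble n : Measure (QU n)) ∗ₘ
    (cliffordEnsemble n : Measure (QU n)), inferInstance⟩

end PFC

end

noncomputable section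

set_option linter.unusedSectionVars false

namespace PFC

/-! The trace norm of a Hermitian `D` equals `Re Tr (W D)` for some unitary `W`, so it suffices to
compare, for a unit vector `ψ` and a unitary `W`, the averages of `Re ⟨W⟩` in the state `U^{⊗t} ψ`
over the two ensembles. By right invariance, a Haar random `U` may be replaced by `U P F C`. With `φ
= C^{⊗t} ψ`, it remains to see that for every fixed `U` the averages over `P` and `F` alone nearly
agree for `P F` and `U P F` (`integral_pfcEnsemble_sub_le`).

Suppose first that `φ` is supported on strings of distinct letters. The random signs kill the
coherences between strings that are not reorderings of each other, and the random permutation turns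
the letters `x` into uniform distinct letters `z` (`pfAverage_twirlForm_of_injective`). What results
is a sum over `x`, `z` of projectors on the vectors `∑_τ |z ∘ τ⟩ ⊗ φ_{x ∘ τ}`. Summed over all `z`
it would be exactly invariant under `U^{⊗t}` (`sum_qform_lift_orbitVec`), so the error comes only
from the `z` with a repeated letter. Their weight is controlled by `∑_z |Stab z| = d(d+1)⋯(d+t-1)`
compared with `d(d-1)⋯(d-t+1)`, a relative excess of order `t²/d`.

The Clifford unitary makes the assumption on `φ` nearly true. The projector onto `a i = a j` is the
mean of `Z ⊗ Z` over all `Z`-strings. Cliffords act transitively on nontrivial Pauli strings, and `∑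
P ⊗ P = d · SWAP`, so each nontrivial string has mean at most `1/(d+1)`. Hence a given pair collides
with weight at most `2/d` (`integral_collWeight_le`), and the mean squared distance of `φ` from the
distinct-letter subspace is at most `2t²/d`. The distance itself, of order `t/√d`, dominates the
final bound. -/

theorem haarProb_isMulRightInvariant (G : Type*) [Group G] [TopologicalSpace G]
    [IsTopologicalGroup G] [CompactSpace G] [MeasurableSpace G] [BorelSpace G] : (haarProb G : Measure G).IsMulRightInvariant := by
  have h : (haarProb G : Measure G) = Measure.haarMeasure ⊤ := rfl
  have : IsProbabilityMeasure (Measure.haarMeasure (⊤ : TopologicalSpace.PositiveCompacts G)) := h ▸ inferInstance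
  rw [h]
  refine ⟨fun g => ?_⟩
  -- A right translate of left Haar measure is left Haar, and still a probability measure, so
  -- uniqueness identifies the two.
  have : IsProbabilityMeasure (Measure.map (fun x => x * g) (Measure.haarMeasure (⊤ : TopologicalSpace.PositiveCompacts G))) := 
    Measure.isProbabilityMeasure_map (by fun_prop)
  exact Measure.isHaarMeasure_eq_of_isProbabilityMeasure _ _

/-! ### Operators acting on the first factor of a bipartite space -/

/-- The operator `M ⊗ 1` on `ℂ^κ ⊗ ℂ^R`. -/
def lift {κ R : Type*} [Fintype κ] [Fintype R] (M : Matrix κ κ ℂ) :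
    EuclideanSpace ℂ (κ × R) →ₗ[ℂ] EuclideanSpace ℂ (κ × R) where
  toFun φ := WithLp.toLp 2 fun p => ∑ b, M p.1 b * φ (b, p.2)
  map_add' φ φ' := by ext p; simp [mul_add, Finset.sum_add_distrib]
  map_smul' c φ := by ext p; simp [Finset.mul_sum, mul_left_comm]

section
variable {κ R : Type*} [Fintype κ] [Fintype R]

@[simp] theorem lift_apply (M : Matrix κ κ ℂ) (φ : EuclideanSpace ℂ (κ × R)) (p : κ × R) :
    lift M φ p = ∑ b, M p.1 b * φ (b, p.2) := rfl

theorem lift_mul (M N : Matrix κ κ ℂ) (φ : EuclideanSpace ℂ (κ × R)) :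
    lift (M * N) φ = lift M (lift N φ) := by
  ext p
  simp only [lift_apply, Matrix.mul_apply, Finset.sum_mul, Finset.mul_sum, mul_assoc]
  exact Finset.sum_comm

theorem lift_one [DecidableEq κ] (φ : EuclideanSpace ℂ (κ × R)) : lift 1 φ = φ := by
  ext p
  simp [Matrix.one_apply]

theorem inner_lift (M : Matrix κ κ ℂ) (φ χ : EuclideanSpace ℂ (κ × R)) :
    inner ℂ φ (lift M χ) = inner ℂ (lift Mᴴ φ) χ := by
  simp only [PiLp.inner_apply, lift_apply, RCLike.inner_apply, Matrix.conjTranspose_apply, map_sum, map_mul,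
    Fintype.sum_prod_type, Finset.sum_mul, Finset.mul_sum, RCLike.star_def, Complex.conj_conj]
  rw [Finset.sum_comm]
  conv_rhs => rw [Finset.sum_comm]
  refine Finset.sum_congr rfl fun r _ => ?_
  rw [Finset.sum_comm]
  refine Finset.sum_congr rfl fun a _ => Finset.sum_congr rfl fun b _ => by ring

theorem norm_lift [DecidableEq κ] {U : Matrix κ κ ℂ} (hU : U ∈ Matrix.unitaryGroup κ ℂ)
    (φ : EuclideanSpace ℂ (κ × R)) : ‖lift U φ‖ = ‖φ‖ := by
  have h : inner ℂ (lift U φ) (lift U φ) = inner ℂ φ φ := by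
    rw [inner_lift, ← lift_mul, ← Matrix.star_eq_conjTranspose, (Matrix.mem_unitaryGroup_iff'.1 hU), lift_one]
  rw [inner_self_eq_norm_sq_to_K, inner_self_eq_norm_sq_to_K] at h
  have h' : ‖lift U φ‖ ^ 2 = ‖φ‖ ^ 2 := by exact_mod_cast h
  exact (sq_eq_sq₀ (norm_nonneg _) (norm_nonneg _)).1 h'

end

/-! ### Quadratic forms and duality for the trace norm -/

section
variable {κ : Type*} [Fintype κ] [DecidableEq κ]

/-- The real part of the quadratic form `⟨φ, W φ⟩`. -/
def qform (W : Matrix κ κ ℂ) (φ : EuclideanSpace ℂ κ) : ℝ := (∑ p, ∑ q, star (φ p) * W p q * φ q).re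

theorem qform_eq_inner (W : Matrix κ κ ℂ) (φ : EuclideanSpace ℂ κ) :
    qform W φ = (inner ℂ φ (Matrix.toEuclideanLin W φ)).re := by
  simp only [qform, PiLp.inner_apply, RCLike.inner_apply, Matrix.toLpLin_apply, Matrix.mulVec, dotProduct, Finset.sum_mul]
  congr 1
  refine Finset.sum_congr rfl fun p _ => Finset.sum_congr rfl fun q _ => by simp; ring

theorem norm_toEuclideanLin_unitary {W : Matrix κ κ ℂ} (hW : W ∈ Matrix.unitaryGroup κ ℂ) (φ : EuclideanSpace ℂ κ) :
    ‖Matrix.toEuclideanLin W φ‖ = ‖φ‖ := by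
  have h : inner ℂ (Matrix.toEuclideanLin W φ) (Matrix.toEuclideanLin W φ) = inner ℂ φ φ := by
    rw [← LinearMap.adjoint_inner_left, ← Matrix.toEuclideanLin_conjTranspose_eq_adjoint]
    rw [← LinearMap.comp_apply, ← Matrix.toLpLin_mul_same, ← Matrix.star_eq_conjTranspose, (Matrix.mem_unitaryGroup_iff'.1 hW)]
    simp
  rw [inner_self_eq_norm_sq_to_K, inner_self_eq_norm_sq_to_K] at h
  have h' : ‖Matrix.toEuclideanLin W φ‖ ^ 2 = ‖φ‖ ^ 2 := by exact_mod_cast h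
  exact (sq_eq_sq₀ (norm_nonneg _) (norm_nonneg _)).1 h'

theorem abs_qform_le {W : Matrix κ κ ℂ} (hW : W ∈ Matrix.unitaryGroup κ ℂ) (φ : EuclideanSpace ℂ κ) :
    |qform W φ| ≤ ‖φ‖ ^ 2 := by
  rw [qform_eq_inner]
  refine (Complex.abs_re_le_norm _).trans ((norm_inner_le_norm _ _).trans ?_)
  rw [norm_toEuclideanLin_unitary hW, sq]

theorem abs_qform_sub_le {W : Matrix κ κ ℂ} (hW : W ∈ Matrix.unitaryGroup κ ℂ) (φ χ : EuclideanSpace ℂ κ) :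
    |qform W φ - qform W χ| ≤ (‖φ‖ + ‖χ‖) * ‖φ - χ‖ := by
  have h : qform W φ - qform W χ = (inner ℂ (φ - χ) (Matrix.toEuclideanLin W φ)).re +
      (inner ℂ χ (Matrix.toEuclideanLin W (φ - χ))).re := by
    rw [qform_eq_inner, qform_eq_inner, map_sub, inner_sub_left, inner_sub_right, Complex.sub_re, Complex.sub_re]
    ring
  rw [h]
  refine (abs_add_le _ _).trans ?_
  have h1 := (Complex.abs_re_le_norm (inner ℂ (φ - χ) (Matrix.toEuclideanLin W φ))).trans (norm_inner_le_norm _ _)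
  have h2 := (Complex.abs_re_le_norm (inner ℂ χ (Matrix.toEuclideanLin W (φ - χ)))).trans (norm_inner_le_norm _ _)
  rw [norm_toEuclideanLin_unitary hW] at h1 h2
  nlinarith

/-- Take `W` to be the sign of `D` in the functional calculus and use `|x| = sign(x) x`. -/
theorem exists_unitary_traceNorm_eq {D : Matrix κ κ ℂ} (hD : D.IsHermitian) :
    ∃ W ∈ Matrix.unitaryGroup κ ℂ, traceNorm D = (W * D).trace.re := by
  -- The value `1` at `0` keeps `s² = 1`, so `s(D)` is unitary even for singular `D`; its
  -- discontinuity is harmless because the spectrum is finite.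
  let s : ℝ → ℝ := fun x => if 0 ≤ x then 1 else -1
  have hc : ∀ (f : ℝ → ℝ), ContinuousOn f (spectrum ℝ D) := fun f =>
    (Matrix.finite_real_spectrum (A := D)).continuousOn f
  have hsa : IsSelfAdjoint D := hD
  refine ⟨cfc s D, ?_, ?_⟩
  · rw [Matrix.mem_unitaryGroup_iff, (cfc_predicate s D : IsSelfAdjoint _).star_eq,
      ← cfc_mul s s D (hc _) (hc _)]
    have : (fun x => s x * s x) = fun _ => (1 : ℝ) := by
      funext x; simp only [s]; split_ifs <;> norm_num
    rw [this, cfc_const_one ℝ D]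
  · have h1 : Dᴴ * D = cfc (fun x : ℝ => x * x) D := by
      rw [cfc_mul (fun x => x) (fun x => x) D (hc _) (hc _), cfc_id' ℝ D, hD.eq]
    have h2 : cfc s D * D = cfc (fun x => s x * x) D := by
      rw [cfc_mul s (fun x => x) D (hc _) (hc _), cfc_id' ℝ D]
    have hcont : ContinuousOn Real.sqrt ((fun x : ℝ => x * x) '' spectrum ℝ D) :=
      Real.continuous_sqrt.continuousOn
    rw [traceNorm, h1, h2, ← cfc_comp' Real.sqrt (fun x => x * x) D hcont (hc _) hsa]
    congr 3
    funext x
    simp only [s]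
    rw [Real.sqrt_mul_self_eq_abs]
    split_ifs with h
    · rw [abs_of_nonneg h, one_mul]
    · rw [abs_of_neg (not_le.1 h)]; ring

end

/-! ### Twirls as averages of quadratic forms; tensor powers -/

section
variable {ι R : Type*} [Fintype ι] [DecidableEq ι] [Fintype R] {t : ℕ}

theorem continuous_tensorPow (t : ℕ) :
    Continuous fun U : Matrix.unitaryGroup ι ℂ => tensorPow t U.1 := by
  refine continuous_matrix fun i j => ?_
  simp only [tensorPow, Matrix.of_apply]
  exact continuous_finsetProd _ fun k _ => continuous_subtype_val.matrix_elem (i k) (j k)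

theorem continuous_lift_tensorPow (ψ : EuclideanSpace ℂ ((Fin t → ι) × R)) :
    Continuous fun U : Matrix.unitaryGroup ι ℂ => lift (tensorPow t U.1) ψ := by
  refine (PiLp.continuous_toLp 2 _).comp (continuous_pi fun p => ?_)
  exact continuous_finsetSum _ fun b _ =>
    ((continuous_tensorPow t).matrix_elem p.1 b).mul continuous_const

theorem continuous_qform {κ : Type*} [Fintype κ] (W : Matrix κ κ ℂ) : Continuous (qform W) := by
  unfold qform
  fun_prop

theorem integrable_of_continuous {X E : Type*} [TopologicalSpace X] [CompactSpace X]
    [MeasurableSpace X] [BorelSpace X] [NormedAddCommGroup E] [SecondCountableTopology E]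
    {f : X → E} (hf : Continuous f) (ν : Measure X) [IsFiniteMeasure ν] : Integrable f ν := by
  borelize E
  exact hf.integrable_of_hasCompactSupport (HasCompactSupport.of_compactSpace _)

theorem twirl_tensorId_proj (ν : ProbabilityMeasure (Matrix.unitaryGroup ι ℂ))
    (ψ : EuclideanSpace ℂ ((Fin t → ι) × R)) (p q : (Fin t → ι) × R) :
    (twirl ν t).tensorId R (proj ψ) p q =
      ∫ U : Matrix.unitaryGroup ι ℂ, lift (tensorPow t U.1) ψ p *
        star (lift (tensorPow t U.1) ψ q) ∂(ν : Measure _) := by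
  change ∫ U : Matrix.unitaryGroup ι ℂ, _ ∂(ν : Measure _) = _
  congr 1
  funext U
  simp only [Matrix.mul_apply, Matrix.of_apply, proj, lift_apply, Matrix.conjTranspose_apply,
    star_sum, star_mul', Finset.sum_mul, Finset.mul_sum]
  refine Finset.sum_congr rfl fun a _ => Finset.sum_congr rfl fun b _ => by ring

/-- Passes from the entrywise twirl to integrals of scalar functions on the group, to which Haar
invariance applies. -/
theorem trace_mul_twirl_tensorId_proj [DecidableEq R]
    (ν : ProbabilityMeasure (Matrix.unitaryGroup ι ℂ)) (ψ : EuclideanSpace ℂ ((Fin t → ι) × R))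
    (W : Matrix ((Fin t → ι) × R) ((Fin t → ι) × R) ℂ) :
    (W * (twirl ν t).tensorId R (proj ψ)).trace.re =
      ∫ U : Matrix.unitaryGroup ι ℂ, qform W (lift (tensorPow t U.1) ψ) ∂(ν : Measure _) := by
  have hc := continuous_lift_tensorPow ψ
  have hi : ∀ p q, Integrable (fun U : Matrix.unitaryGroup ι ℂ =>
      star (lift (tensorPow t U.1) ψ p) * W p q * lift (tensorPow t U.1) ψ q) (ν : Measure _) :=
    fun p q => integrable_of_continuous
      ((show Continuous fun φ : EuclideanSpace ℂ ((Fin t → ι) × R) => star (φ p) * W p q * φ q by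
        fun_prop).comp hc) _
  unfold qform
  have h := integral_re (μ := (ν : Measure (Matrix.unitaryGroup ι ℂ)))
    (f := fun U : Matrix.unitaryGroup ι ℂ => ∑ p, ∑ q,
      star (lift (tensorPow t U.1) ψ p) * W p q * lift (tensorPow t U.1) ψ q)
    (integrable_finsetSum _ fun p _ => integrable_finsetSum _ fun q _ => hi p q)
  simp only [RCLike.re_to_complex] at h
  rw [h, integral_finsetSum _ fun p _ => integrable_finsetSum _ fun q _ => hi p q]
  simp only [Matrix.trace, Matrix.diag_apply, Matrix.mul_apply, twirl_tensorId_proj]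
  congr 1
  refine Finset.sum_congr rfl fun p _ => ?_
  rw [integral_finsetSum _ fun q _ => hi p q]
  refine Finset.sum_congr rfl fun q _ => ?_
  rw [← integral_const_mul]
  congr 1
  funext U
  ring

theorem twirl_tensorId_proj_isHermitian (ν : ProbabilityMeasure (Matrix.unitaryGroup ι ℂ))
    (ψ : EuclideanSpace ℂ ((Fin t → ι) × R)) :
    ((twirl ν t).tensorId R (proj ψ)).IsHermitian := by
  ext p q
  rw [Matrix.conjTranspose_apply, twirl_tensorId_proj, twirl_tensorId_proj]
  refine integral_conj.symm.trans ?_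
  congr 1
  funext U
  simp [mul_comm]

theorem traceNorm_twirl_sub_le [DecidableEq R] {ν μ : ProbabilityMeasure (Matrix.unitaryGroup ι ℂ)}
    {ψ : EuclideanSpace ℂ ((Fin t → ι) × R)} {ε : ℝ}
    (h : ∀ W ∈ Matrix.unitaryGroup ((Fin t → ι) × R) ℂ,
      ∫ U : Matrix.unitaryGroup ι ℂ, qform W (lift (tensorPow t U.1) ψ) ∂(ν : Measure _) -
        ∫ U : Matrix.unitaryGroup ι ℂ, qform W (lift (tensorPow t U.1) ψ) ∂(μ : Measure _) ≤ ε) :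
    traceNorm ((twirl ν t).tensorId R (proj ψ) - (twirl μ t).tensorId R (proj ψ)) ≤ ε := by
  obtain ⟨W, hW, hD⟩ := exists_unitary_traceNorm_eq
    ((twirl_tensorId_proj_isHermitian ν ψ).sub (twirl_tensorId_proj_isHermitian μ ψ))
  rw [hD, Matrix.mul_sub, Matrix.trace_sub, Complex.sub_re, trace_mul_twirl_tensorId_proj,
    trace_mul_twirl_tensorId_proj]
  exact h W hW

theorem isDiamondApproxDesign_of_qform {ν : ProbabilityMeasure (Matrix.unitaryGroup ι ℂ)} {ε : ℝ}
    (h : ∀ ψ : EuclideanSpace ℂ ((Fin t → ι) × (Fin t → ι)), ‖ψ‖ = 1 →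
      ∀ W ∈ Matrix.unitaryGroup ((Fin t → ι) × (Fin t → ι)) ℂ,
      ∫ U : Matrix.unitaryGroup ι ℂ, qform W (lift (tensorPow t U.1) ψ) ∂(ν : Measure _) -
        ∫ U : Matrix.unitaryGroup ι ℂ, qform W (lift (tensorPow t U.1) ψ)
          ∂(haarProb (Matrix.unitaryGroup ι ℂ) : Measure _) ≤ ε) :
    IsDiamondApproxDesign ν ε t :=
  iSup_le fun ψ => EReal.coe_le_coe_iff.2 (traceNorm_twirl_sub_le (h ψ.1 ψ.2))

/-- The tensor product `A 0 ⊗ A 1 ⊗ ⋯` of a family of matrices. -/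
def tprod {t : ℕ} (A : Fin t → Matrix ι ι ℂ) : Matrix (Fin t → ι) (Fin t → ι) ℂ :=
  Matrix.of fun a b => ∏ k, A k (a k) (b k)

theorem tensorPow_eq_tprod (t : ℕ) (U : Matrix ι ι ℂ) : tensorPow t U = tprod fun _ => U := rfl

theorem tprod_mul (A B : Fin t → Matrix ι ι ℂ) : tprod A * tprod B = tprod fun k => A k * B k := by
  ext x y
  simp only [tprod, Matrix.mul_apply, Matrix.of_apply, ← Finset.prod_mul_distrib]
  exact (Finset.prod_univ_sum (fun _ => Finset.univ) (fun i z => A i (x i) z * B i z (y i))).symm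

theorem tprod_conjTranspose (A : Fin t → Matrix ι ι ℂ) : (tprod A)ᴴ = tprod fun k => (A k)ᴴ := by
  ext x y
  simp [tprod, Matrix.conjTranspose_apply]

theorem tprod_one : tprod (fun _ : Fin t => (1 : Matrix ι ι ℂ)) = 1 := by
  ext x y
  simp [tprod, Matrix.one_apply, Finset.prod_ite_zero, funext_iff]

theorem tprod_smul (s : Fin t → ℂ) (A : Fin t → Matrix ι ι ℂ) :
    tprod (fun k => s k • A k) = (∏ k, s k) • tprod A := by
  ext x y
  simp [tprod, Finset.prod_mul_distrib]

theorem tensorPow_mul (t : ℕ) (U V : Matrix ι ι ℂ) :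
    tensorPow t (U * V) = tensorPow t U * tensorPow t V := by
  simp only [tensorPow_eq_tprod, tprod_mul]

theorem tensorPow_mem_unitaryGroup (t : ℕ) (U : Matrix.unitaryGroup ι ℂ) :
    tensorPow t U.1 ∈ Matrix.unitaryGroup (Fin t → ι) ℂ := by
  have h : U.1 * U.1ᴴ = 1 := Matrix.mem_unitaryGroup_iff.1 U.2
  rw [Matrix.mem_unitaryGroup_iff, Matrix.star_eq_conjTranspose, tensorPow_eq_tprod,
    tprod_conjTranspose, tprod_mul]
  simp only [h, tprod_one]

theorem norm_lift_tensorPow (U : Matrix.unitaryGroup ι ℂ)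
    (φ : EuclideanSpace ℂ ((Fin t → ι) × R)) : ‖lift (tensorPow t U.1) φ‖ = ‖φ‖ :=
  norm_lift (tensorPow_mem_unitaryGroup t U) φ

end

/-! ### Pauli strings and the Cliffords that exchange them -/

section Pauli

/-- The sign `±1` with which two single-qubit Pauli matrices commute. -/
def pauliSign (a b : Fin 4) : ℂ := if a = 0 ∨ b = 0 ∨ a = b then 1 else -1

theorem pauli_mul_comm (a b : Fin 4) :
    pauli a * pauli b = pauliSign a b • (pauli b * pauli a) := by
  fin_cases a <;> fin_cases b <;> simp [pauli, pauliSign]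

theorem pauli_mul_self (a : Fin 4) : pauli a * pauli a = 1 := by
  fin_cases a <;> simp [pauli, Matrix.one_fin_two]

variable {n : ℕ}

theorem pauliString_eq_tprod (p : Fin n → Fin 4) : pauliString p = tprod fun k => pauli (p k) := rfl

theorem pauliString_mul_self (p : Fin n → Fin 4) : pauliString p * pauliString p = 1 := by
  simp only [pauliString_eq_tprod, tprod_mul, pauli_mul_self, tprod_one]

/-- The sign `±1` with which two Pauli strings commute. -/
def stringSign (p q : Fin n → Fin 4) : ℂ := ∏ k, pauliSign (p k) (q k)

theorem pauliString_mul_comm (p q : Fin n → Fin 4) :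
    pauliString p * pauliString q = stringSign p q • (pauliString q * pauliString p) := by
  simp only [pauliString_eq_tprod, tprod_mul, stringSign, ← tprod_smul, ← pauli_mul_comm]

theorem stringSign_eq (p q : Fin n → Fin 4) : stringSign p q = 1 ∨ stringSign p q = -1 := by
  unfold stringSign
  refine Finset.prod_induction _ (fun x : ℂ => x = 1 ∨ x = -1) ?_ (Or.inl rfl) fun k _ => ?_
  · rintro _ _ (rfl | rfl) (rfl | rfl) <;> simp
  · unfold pauliSign; split_ifs <;> simp

theorem stringSign_single (p : Fin n → Fin 4) (i : Fin n) (c : Fin 4) :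
    stringSign p (Pi.single i c) = pauliSign (p i) c := by
  unfold stringSign
  rw [Finset.prod_eq_single i]
  · simp
  · intro k _ hk; simp [hk, pauliSign]
  · simp

theorem stringSign_add_single (p : Fin n → Fin 4) {i j : Fin n} (hij : i ≠ j) (c d : Fin 4) :
    stringSign p (Pi.single i c + Pi.single j d) = pauliSign (p i) c * pauliSign (p j) d := by
  unfold stringSign
  rw [Finset.prod_eq_mul i j hij]
  · simp [hij, hij.symm]
  · intro k _ hk; simp [hk.1, hk.2, pauliSign]
  · simp
  · simp

theorem exists_pauliSign_eq_neg_one {a b : Fin 4} (ha : a ≠ 0) (hb : b ≠ 0) :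
    ∃ c, pauliSign a c = -1 ∧ pauliSign b c = -1 := by
  have : ∀ a b : Fin 4, a ≠ 0 → b ≠ 0 →
      ∃ c : Fin 4, ¬(a = 0 ∨ c = 0 ∨ a = c) ∧ ¬(b = 0 ∨ c = 0 ∨ b = c) := by decide
  obtain ⟨c, h1, h2⟩ := this a b ha hb
  exact ⟨c, if_neg h1, if_neg h2⟩

/-- Links any two nontrivial strings through a third one that anticommutes with both. A site in both
supports needs one letter; otherwise one letter is placed on a site of each. -/
theorem exists_stringSign_eq_neg_one {p q : Fin n → Fin 4} (hp : p ≠ 0) (hq : q ≠ 0) :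
    ∃ r, stringSign p r = -1 ∧ stringSign q r = -1 := by
  obtain ⟨i, hi⟩ := Function.ne_iff.1 hp
  obtain ⟨j, hj⟩ := Function.ne_iff.1 hq
  by_cases hqi : q i = 0
  · by_cases hpj : p j = 0
    · have hij : i ≠ j := by rintro rfl; exact hi hpj
      obtain ⟨c, hc, -⟩ := exists_pauliSign_eq_neg_one hi hi
      obtain ⟨d, hd, -⟩ := exists_pauliSign_eq_neg_one hj hj
      refine ⟨Pi.single i c + Pi.single j d, ?_, ?_⟩ <;>
        simp [stringSign_add_single _ hij, hc, hd, hqi, hpj, pauliSign.eq_1 0]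
    · obtain ⟨c, hc, hd⟩ := exists_pauliSign_eq_neg_one hpj hj
      exact ⟨Pi.single j c, by simp [stringSign_single, hc, hd]⟩
  · obtain ⟨c, hc, hd⟩ := exists_pauliSign_eq_neg_one hi hqi
    exact ⟨Pi.single i c, by simp [stringSign_single, hc, hd]⟩

theorem mem_pauliGroup_of_eq {U : QU n} {M N : QU n} (hM : M ∈ pauliGroup n) (hN : N ∈ pauliGroup n)
    (h : U.1 = M.1 * N.1) : U ∈ pauliGroup n := by
  have : U = M * N := Subtype.ext h
  exact this ▸ mul_mem hM hN

theorem pauliString_mem_unitaryGroup (p : Fin n → Fin 4) :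
    pauliString p ∈ Matrix.unitaryGroup (Bits n) ℂ := by
  rw [Matrix.mem_unitaryGroup_iff, Matrix.star_eq_conjTranspose, pauliString_conjTranspose,
    pauliString_mul_self]

/-- Two Pauli strings `P`, `Q` that anticommute are exchanged by conjugation with the Clifford
unitary `(P + Q) / √2`. -/
theorem exists_clifford_conj {p q : Fin n → Fin 4} (h : stringSign p q = -1) :
    ∃ U : QU n, U ∈ cliffordGroup n ∧ U.1ᴴ * pauliString p * U.1 = pauliString q := by
  set P := pauliString p with hPdef
  set Q := pauliString q with hQdef
  have hP : P * P = 1 := pauliString_mul_self p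
  have hQ : Q * Q = 1 := pauliString_mul_self q
  have hPQ : P * Q = -(Q * P) := by
    have := pauliString_mul_comm p q
    rw [h, neg_one_smul] at this
    exact this
  set c : ℂ := (((Real.sqrt 2)⁻¹ : ℝ) : ℂ) with hc
  have hcc : c * c = 2⁻¹ := by
    rw [hc, ← Complex.ofReal_mul, ← mul_inv, Real.mul_self_sqrt (by norm_num)]
    norm_num
  have hsc : star c = c := by simp [hc]
  set H := c • (P + Q) with hH
  have hHs : Hᴴ = H := by
    rw [hH, Matrix.conjTranspose_smul, Matrix.conjTranspose_add, pauliString_conjTranspose,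
      pauliString_conjTranspose, hsc]
  have hconj : ∀ M, H * M * H = (2⁻¹ : ℂ) • ((P + Q) * M * (P + Q)) := fun M => by
    rw [hH, Matrix.smul_mul, Matrix.smul_mul, Matrix.mul_smul, smul_smul, hcc]
  have hPQsq : (P + Q) * (P + Q) = (2 : ℂ) • 1 := by
    rw [Matrix.add_mul, Matrix.mul_add, Matrix.mul_add, hP, hQ, hPQ, two_smul]
    abel
  have hHH : H * H = 1 := by
    have := hconj 1
    rw [Matrix.mul_one, Matrix.mul_one, hPQsq, smul_smul] at this
    simpa using this
  have hHu : H ∈ Matrix.unitaryGroup (Bits n) ℂ := by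
    rw [Matrix.mem_unitaryGroup_iff, Matrix.star_eq_conjTranspose, hHs, hHH]
  have hmemP : (⟨P, pauliString_mem_unitaryGroup p⟩ : QU n) ∈ pauliGroup n :=
    ⟨0, p, by simp [hPdef]⟩
  have hmemQ : (⟨Q, pauliString_mem_unitaryGroup q⟩ : QU n) ∈ pauliGroup n :=
    ⟨0, q, by simp [hQdef]⟩
  set U : QU n := ⟨H, hHu⟩ with hU
  have hUU : U * U = 1 := Subtype.ext hHH
  have hUinv : U⁻¹ = U := inv_eq_of_mul_eq_one_left hUU
  have key : ∀ V ∈ pauliGroup n, U * V * U⁻¹ ∈ pauliGroup n := by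
    rintro V ⟨k, r, hV⟩
    have hVmem : V ∈ pauliGroup n := ⟨k, r, hV⟩
    have hnegmem : (-V) ∈ pauliGroup n := ⟨k + 2, r, by
      change -V.1 = _
      rw [hV, pow_add, Complex.I_sq, mul_neg_one, neg_smul]⟩
    rw [hUinv]
    have hcomm : ∀ s, pauliString s * V.1 = stringSign s r • (V.1 * pauliString s) := fun s => by
      rw [hV, Matrix.mul_smul, pauliString_mul_comm, Matrix.smul_mul, smul_comm]
    have hUVU : (U * V * U).1 = (2⁻¹ : ℂ) • ((P + Q) * V.1 * (P + Q)) := hconj V.1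
    have h2 : ∀ M : Matrix (Bits n) (Bits n) ℂ, (2⁻¹ : ℂ) • (M + M) = M := fun M => by
      rw [← two_smul ℂ, smul_smul]; norm_num
    have hP' := hcomm p
    have hQ' := hcomm q
    rw [← hPdef] at hP'
    rw [← hQdef] at hQ'
    -- According to the signs with which `V` commutes with `P` and `Q`, the conjugate `(P + Q) V (P
    -- + Q) / 2` is `V`, `V P Q`, `V Q P` or `-V`.
    rcases stringSign_eq p r with hp | hp <;> rcases stringSign_eq q r with hq | hq <;>
      rw [hp] at hP' <;> rw [hq] at hQ' <;>
      simp only [one_smul, neg_one_smul] at hP' hQ' <;>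
      rw [Matrix.add_mul, hP', hQ'] at hUVU
    · convert hVmem using 1
      refine Subtype.ext (hUVU.trans ?_)
      rw [← Matrix.mul_add, Matrix.mul_assoc, hPQsq, Matrix.mul_smul, Matrix.mul_one, smul_smul]
      norm_num
    · refine mem_pauliGroup_of_eq hVmem (mul_mem hmemP hmemQ) (hUVU.trans ?_)
      change _ = V.1 * (P * Q)
      rw [← sub_eq_add_neg, ← Matrix.mul_sub, Matrix.mul_assoc, Matrix.sub_mul, Matrix.mul_add,
        Matrix.mul_add, hP, hQ, eq_neg_of_add_eq_zero_left (a := Q * P) (b := P * Q) (by rw [hPQ]; abel)]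
      convert h2 (V.1 * (P * Q)) using 2
      rw [← Matrix.mul_add]
      congr 1
      abel
    · refine mem_pauliGroup_of_eq hVmem (mul_mem hmemQ hmemP) (hUVU.trans ?_)
      change _ = V.1 * (Q * P)
      rw [neg_add_eq_sub, ← Matrix.mul_sub, Matrix.mul_assoc, Matrix.sub_mul, Matrix.mul_add,
        Matrix.mul_add, hP, hQ, hPQ]
      convert h2 (V.1 * (Q * P)) using 2
      rw [← Matrix.mul_add]
      congr 1
      abel
    · convert hnegmem using 1
      refine Subtype.ext (hUVU.trans ?_)
      change _ = -V.1
      rw [← neg_add, ← Matrix.mul_add, Matrix.neg_mul, Matrix.mul_assoc, hPQsq, Matrix.mul_smul,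
        Matrix.mul_one, smul_neg, smul_smul]
      norm_num
  refine ⟨U, ?_, ?_⟩
  -- `U` is an involution, so stability under conjugation by `U` also gives the converse
  -- implication.
  · refine Subgroup.mem_normalizer_iff.2 fun V => ⟨key V, fun hV => ?_⟩
    have := key _ hV
    rw [hUinv] at this
    have e : U * (U * V * U) * U = V := by
      rw [show U * (U * V * U) * U = (U * U) * V * (U * U) by group, hUU, one_mul, mul_one]
    rwa [e] at this
  · change Hᴴ * P * H = Q
    rw [hHs, hconj, Matrix.add_mul, hP, Matrix.add_mul, Matrix.mul_add, Matrix.one_mul,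
      Matrix.mul_assoc, Matrix.mul_add, hP, hPQ, Matrix.mul_add, Matrix.mul_neg,
      ← Matrix.mul_assoc, hQ, Matrix.mul_one, Matrix.one_mul,
      Matrix.one_mul, show P + Q + (Q + -P) = (2 : ℂ) • Q by rw [two_smul]; abel, smul_smul]
    norm_num

/-- In operator form: `∑ σ ⊗ σ = 2 SWAP` on two qubits. -/
theorem sum_pauli_mul_pauli (x y z w : Fin 2) :
    ∑ a, pauli a x y * pauli a z w = if y = z ∧ w = x then 2 else 0 := by
  rw [Fin.sum_univ_four]
  fin_cases x <;> fin_cases y <;> fin_cases z <;> fin_cases w <;> simp [pauli] <;> norm_num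

/-- In operator form: `1 ⊗ 1 + Z ⊗ Z` is twice the projector onto equal bits. -/
theorem sum_pauli_diagonal (x y z w : Fin 2) :
    ∑ s : Fin 2, pauli (![0, 3] s) x y * pauli (![0, 3] s) z w =
      if x = y ∧ z = w ∧ x = z then 2 else 0 := by
  rw [Fin.sum_univ_two]
  fin_cases x <;> fin_cases y <;> fin_cases z <;> fin_cases w <;> simp [pauli] <;> norm_num

theorem sum_pauliString_mul_pauliString (x y z w : Bits n) :
    ∑ p : Fin n → Fin 4, pauliString p x y * pauliString p z w =
      if y = z ∧ w = x then 2 ^ n else 0 := by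
  simp only [pauliString, Matrix.of_apply, ← Finset.prod_mul_distrib]
  refine (Finset.prod_univ_sum (fun _ => Finset.univ)
    (fun k a => pauli a (x k) (y k) * pauli a (z k) (w k))).symm.trans ?_
  simp only [sum_pauli_mul_pauli, Finset.prod_ite_zero, funext_iff, Finset.mem_univ, true_implies,
    forall_and, Finset.prod_const, Finset.card_univ, Fintype.card_fin]

/-- The Pauli string with a `Z` wherever `z` is `1`. -/
def zString (z : Bits n) : Fin n → Fin 4 := fun k => ![0, 3] (z k)

theorem sum_zString (x y u w : Bits n) :
    ∑ z : Bits n, pauliString (zString z) x y * pauliString (zString z) u w =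
      if x = y ∧ u = w ∧ x = u then 2 ^ n else 0 := by
  simp only [pauliString, zString, Matrix.of_apply, ← Finset.prod_mul_distrib]
  refine (Finset.prod_univ_sum (fun _ => Finset.univ)
    (fun k s => pauli (![0, 3] s) (x k) (y k) * pauli (![0, 3] s) (u k) (w k))).symm.trans ?_
  simp only [sum_pauli_diagonal, Finset.prod_ite_zero, funext_iff, Finset.mem_univ, true_implies,
    forall_and, Finset.prod_const, Finset.card_univ, Fintype.card_fin]

theorem zString_eq_zero_iff (z : Bits n) : zString z = 0 ↔ z = 0 := by
  have : ∀ s : Fin 2, (![0, 3] s : Fin 4) = 0 ↔ s = 0 := by decide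
  simp [funext_iff, zString, this]

end Pauli

/-! ### Expectations of `M ⊗ M` on a pair of tensor factors -/

section
variable {ι R : Type*} [Fintype ι] [DecidableEq ι] [Fintype R] {t : ℕ}

/-- `M` acting on the tensor factors `i` and `j`, and the identity on the others. -/
def pairOp (i j : Fin t) (M : Matrix ι ι ℂ) : Matrix (Fin t → ι) (Fin t → ι) ℂ :=
  tprod fun k => if k = i ∨ k = j then M else 1

theorem pairOp_conj (i j : Fin t) (M : Matrix ι ι ℂ) (U : Matrix.unitaryGroup ι ℂ) :
    (tensorPow t U.1)ᴴ * pairOp i j M * tensorPow t U.1 = pairOp i j (U.1ᴴ * M * U.1) := by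
  have h : U.1ᴴ * U.1 = 1 := Matrix.mem_unitaryGroup_iff'.1 U.2
  simp only [tensorPow_eq_tprod, tprod_conjTranspose, pairOp, tprod_mul]
  congr 1
  funext k
  split_ifs <;> simp [h]

theorem pairOp_one (i j : Fin t) : pairOp i j (1 : Matrix ι ι ℂ) = 1 := by
  simp only [pairOp, ite_self, tprod_one]

theorem pairOp_apply {i j : Fin t} (hij : i ≠ j) (M : Matrix ι ι ℂ) (a b : Fin t → ι) :
    pairOp i j M a b = M (a i) (b i) * M (a j) (b j) *
      if ∀ k, k ≠ i ∧ k ≠ j → a k = b k then 1 else 0 := by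
  classical
  simp only [pairOp, tprod, Matrix.of_apply]
  rw [← Finset.mul_prod_erase _ _ (Finset.mem_univ i), ← Finset.mul_prod_erase _ _
    (Finset.mem_erase.2 ⟨hij.symm, Finset.mem_univ j⟩), ← mul_assoc]
  simp only [true_or, or_true, if_true]
  congr 1
  rw [Finset.prod_congr rfl (g := fun k => if a k = b k then (1 : ℂ) else 0), Finset.prod_ite_zero]
  · simp only [Finset.prod_const_one]
    refine if_congr ?_ rfl rfl
    simp [and_imp]
    exact ⟨fun h k h1 h2 => h k h2 h1, fun h k h1 h2 => h k h2 h1⟩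
  · intro k hk
    simp only [Finset.mem_erase] at hk
    rw [if_neg (by tauto), Matrix.one_apply]

/-- The expectation value of `M ⊗ M` on the tensor factors `i` and `j`. -/
def pairExp (i j : Fin t) (M : Matrix ι ι ℂ) (φ : EuclideanSpace ℂ ((Fin t → ι) × R)) : ℝ :=
  (inner ℂ φ (lift (pairOp i j M) φ)).re

theorem pairExp_lift (i j : Fin t) (M : Matrix ι ι ℂ) (U : Matrix.unitaryGroup ι ℂ)
    (φ : EuclideanSpace ℂ ((Fin t → ι) × R)) :
    pairExp i j M (lift (tensorPow t U.1) φ) = pairExp i j (U.1ᴴ * M * U.1) φ := by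
  rw [pairExp, pairExp, ← pairOp_conj, lift_mul, lift_mul,
    inner_lift (tensorPow t U.1)ᴴ φ, Matrix.conjTranspose_conjTranspose]

theorem pairExp_one (i j : Fin t) (φ : EuclideanSpace ℂ ((Fin t → ι) × R)) :
    pairExp i j (1 : Matrix ι ι ℂ) φ = ‖φ‖ ^ 2 := by
  rw [pairExp, pairOp_one, lift_one, inner_self_eq_norm_sq_to_K]
  norm_cast

theorem pairExp_eq_sum (i j : Fin t) (M : Matrix ι ι ℂ)
    (φ : EuclideanSpace ℂ ((Fin t → ι) × R)) :
    pairExp i j M φ = ∑ a, ∑ r, ∑ b, (star (φ (a, r)) * φ (b, r) * pairOp i j M a b).re := by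
  simp only [pairExp, PiLp.inner_apply, RCLike.inner_apply, lift_apply, Fintype.sum_prod_type,
    Finset.sum_mul, Complex.re_sum]
  refine Finset.sum_congr rfl fun a _ => Finset.sum_congr rfl fun r _ =>
    Finset.sum_congr rfl fun b _ => ?_
  congr 1
  simp only [RCLike.star_def]
  ring

/-- The weight of `φ` on the strings whose `i`-th and `j`-th letters agree. -/
def collWeight (i j : Fin t) (φ : EuclideanSpace ℂ ((Fin t → ι) × R)) : ℝ :=
  ∑ p : (Fin t → ι) × R, if p.1 i = p.1 j then ‖φ p‖ ^ 2 else 0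

theorem continuous_pairExp (i j : Fin t) (M : Matrix ι ι ℂ) :
    Continuous (pairExp i j M : EuclideanSpace ℂ ((Fin t → ι) × R) → ℝ) := by
  have : (pairExp i j M : EuclideanSpace ℂ ((Fin t → ι) × R) → ℝ) = fun φ =>
      ∑ a, ∑ r, ∑ b, (star (φ (a, r)) * φ (b, r) * pairOp i j M a b).re :=
    funext (pairExp_eq_sum i j M)
  rw [this]
  fun_prop

end

/-! ### Collisions after a random Clifford unitary -/

section
variable {n t : ℕ} {R : Type*} [Fintype R]

theorem sum_pairOp_pauliString {i j : Fin t} (hij : i ≠ j) (a b : Fin t → Bits n) :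
    ∑ p, pairOp i j (pauliString p) a b = if b = a ∘ Equiv.swap i j then (2 : ℂ) ^ n else 0 := by
  simp only [pairOp_apply hij]
  rw [← Finset.sum_mul, sum_pauliString_mul_pauliString, ite_zero_mul_ite_zero, mul_one]
  refine if_congr ?_ rfl rfl
  constructor
  · rintro ⟨⟨h1, h2⟩, h3⟩
    funext k
    by_cases hi : k = i
    · subst hi; simp [h1]
    · by_cases hj : k = j
      · subst hj; simp [h2]
      · simp [Equiv.swap_apply_of_ne_of_ne hi hj, h3 k ⟨hi, hj⟩]
  · rintro rfl
    refine ⟨⟨by simp, by simp⟩, fun k hk => ?_⟩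
    simp [Equiv.swap_apply_of_ne_of_ne hk.1 hk.2]

theorem sum_pairOp_zString {i j : Fin t} (hij : i ≠ j) (a b : Fin t → Bits n) :
    ∑ z, pairOp i j (pauliString (zString z)) a b =
      if a i = a j ∧ b = a then (2 : ℂ) ^ n else 0 := by
  simp only [pairOp_apply hij]
  rw [← Finset.sum_mul, sum_zString, ite_zero_mul_ite_zero, mul_one]
  refine if_congr ?_ rfl rfl
  constructor
  · rintro ⟨⟨h1, h2, h4⟩, h3⟩
    refine ⟨h4, ?_⟩
    funext k
    by_cases hi : k = i
    · subst hi; simp [h1]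
    · by_cases hj : k = j
      · subst hj; simp [h2]
      · exact (h3 k ⟨hi, hj⟩).symm
  · rintro ⟨h, rfl⟩
    exact ⟨⟨rfl, rfl, h⟩, fun _ _ => rfl⟩

/-- The sum of the operators is `2^n` times the swap of factors `i` and `j`. The swap permutes the
basis, so `Re (ū v) ≤ (|u|² + |v|²) / 2` bounds its expectation by `‖φ‖²`. -/
theorem sum_pairExp_pauliString_le {i j : Fin t} (hij : i ≠ j)
    (φ : EuclideanSpace ℂ ((Fin t → Bits n) × R)) :
    ∑ p, pairExp i j (pauliString p) φ ≤ 2 ^ n * ‖φ‖ ^ 2 := by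
  have h1 : ∑ p, pairExp i j (pauliString p) φ =
      2 ^ n * ∑ a, ∑ r, (star (φ (a, r)) * φ (a ∘ Equiv.swap i j, r)).re := by
    simp only [pairExp_eq_sum]
    rw [Finset.sum_comm, Finset.mul_sum]
    refine Finset.sum_congr rfl fun a _ => ?_
    rw [Finset.sum_comm, Finset.mul_sum]
    refine Finset.sum_congr rfl fun r _ => ?_
    rw [Finset.sum_comm]
    simp only [← Complex.re_sum, ← Finset.mul_sum, sum_pairOp_pauliString hij, mul_ite, mul_zero,
      Finset.sum_ite_eq', Finset.mem_univ, if_true]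
    rw [mul_comm]
    have : ((2 : ℂ) ^ n) = (((2 : ℝ) ^ n : ℝ) : ℂ) := by push_cast; rfl
    rw [this, Complex.re_ofReal_mul]
  rw [h1]
  refine mul_le_mul_of_nonneg_left ?_ (by positivity)
  have hb : ∀ u v : ℂ, (star u * v).re ≤ (‖u‖ ^ 2 + ‖v‖ ^ 2) / 2 := fun u v => by
    refine (Complex.re_le_norm _).trans ?_
    rw [norm_mul, norm_star]
    nlinarith [sq_nonneg (‖u‖ - ‖v‖)]
  have hre : ∑ a : Fin t → Bits n, ∑ r, ‖φ (a ∘ Equiv.swap i j, r)‖ ^ 2 = ∑ a, ∑ r, ‖φ (a, r)‖ ^ 2 :=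
    Equiv.sum_comp ((Equiv.swap i j).symm.arrowCongr (Equiv.refl (Bits n)))
      fun a => ∑ r, ‖φ (a, r)‖ ^ 2
  have hn : ‖φ‖ ^ 2 = ∑ a, ∑ r, ‖φ (a, r)‖ ^ 2 := by
    rw [EuclideanSpace.norm_sq_eq, Fintype.sum_prod_type]
  calc ∑ a, ∑ r, (star (φ (a, r)) * φ (a ∘ Equiv.swap i j, r)).re
      ≤ ∑ a : Fin t → Bits n, ∑ r, (‖φ (a, r)‖ ^ 2 + ‖φ (a ∘ Equiv.swap i j, r)‖ ^ 2) / 2 :=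
        Finset.sum_le_sum fun a _ => Finset.sum_le_sum fun r _ => hb _ _
    _ = ‖φ‖ ^ 2 := by
        simp only [← Finset.sum_div, Finset.sum_add_distrib]
        rw [hre, hn]
        ring

/-- Expresses a collision weight through Pauli expectations, whose Clifford averages can be bounded.
-/
theorem sum_pairExp_zString {i j : Fin t} (hij : i ≠ j)
    (φ : EuclideanSpace ℂ ((Fin t → Bits n) × R)) :
    ∑ z, pairExp i j (pauliString (zString z)) φ = 2 ^ n * collWeight i j φ := by
  simp only [pairExp_eq_sum, collWeight, Fintype.sum_prod_type]
  rw [Finset.sum_comm, Finset.mul_sum]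
  refine Finset.sum_congr rfl fun a _ => ?_
  rw [Finset.sum_comm, Finset.mul_sum]
  refine Finset.sum_congr rfl fun r _ => ?_
  rw [Finset.sum_comm]
  simp only [← Complex.re_sum, ← Finset.mul_sum, sum_pairOp_zString hij]
  by_cases h : a i = a j
  · simp only [h, true_and, if_true, mul_ite, mul_zero, Finset.sum_ite_eq',
      Finset.mem_univ]
    rw [mul_comm]
    have : ((2 : ℂ) ^ n) = (((2 : ℝ) ^ n : ℝ) : ℂ) := by push_cast; rfl
    rw [this, Complex.re_ofReal_mul, mul_comm (star _), RCLike.star_def, Complex.mul_conj,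
      Complex.ofReal_re, Complex.normSq_eq_norm_sq]
  · simp [h]

/-- The average of `pairExp` over the Clifford orbit of `ψ`. -/
def cliffordPairExp (i j : Fin t) (ψ : EuclideanSpace ℂ ((Fin t → Bits n) × R))
    (p : Fin n → Fin 4) : ℝ :=
  ∫ U, pairExp i j (pauliString p) (lift (tensorPow t U.1) ψ) ∂(cliffordEnsemble n : Measure (QU n))

theorem integral_cliffordEnsemble (f : QU n → ℝ) (hf : Continuous f) :
    ∫ U, f U ∂(cliffordEnsemble n : Measure (QU n)) =
      ∫ U : cliffordGroup n, f U.1 ∂(haarProb (cliffordGroup n) : Measure (cliffordGroup n)) :=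
  integral_map measurable_subtype_coe.aemeasurable hf.aestronglyMeasurable

instance (G : Type*) [Group G] [TopologicalSpace G] [IsTopologicalGroup G] [CompactSpace G]
    [MeasurableSpace G] [BorelSpace G] : (haarProb G : Measure G).IsMulLeftInvariant :=
  inferInstanceAs (Measure.haarMeasure (⊤ : TopologicalSpace.PositiveCompacts G)).IsMulLeftInvariant

theorem integral_cliffordEnsemble_mul_left {V : QU n} (hV : V ∈ cliffordGroup n) (f : QU n → ℝ)
    (hf : Continuous f) :
    ∫ U, f (V * U) ∂(cliffordEnsemble n : Measure (QU n)) =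
      ∫ U, f U ∂(cliffordEnsemble n : Measure (QU n)) := by
  rw [integral_cliffordEnsemble f hf,
    integral_cliffordEnsemble (fun U => f (V * U)) (by fun_prop)]
  exact integral_mul_left_eq_self (μ := (haarProb (cliffordGroup n) : Measure (cliffordGroup n)))
    (fun U : cliffordGroup n => f U.1) ⟨V, hV⟩

theorem continuous_pairExp_lift (i j : Fin t) (M : Matrix (Bits n) (Bits n) ℂ)
    (ψ : EuclideanSpace ℂ ((Fin t → Bits n) × R)) :
    Continuous fun U : QU n => pairExp i j M (lift (tensorPow t U.1) ψ) :=
  (continuous_pairExp i j M).comp (continuous_lift_tensorPow ψ)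

/-- Translating by the Clifford unitary that carries one string to the other does not change the
average. -/
theorem cliffordPairExp_eq_of_anticommute (i j : Fin t)
    (ψ : EuclideanSpace ℂ ((Fin t → Bits n) × R)) {p q : Fin n → Fin 4}
    (h : stringSign p q = -1) : cliffordPairExp i j ψ p = cliffordPairExp i j ψ q := by
  obtain ⟨V, hV, hpq⟩ := exists_clifford_conj h
  rw [cliffordPairExp, ← integral_cliffordEnsemble_mul_left hV _ (continuous_pairExp_lift i j _ ψ)]
  unfold cliffordPairExp
  congr 1
  funext U
  rw [show (V * U).1 = V.1 * U.1 from rfl, tensorPow_mul, lift_mul, pairExp_lift, hpq]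

theorem cliffordPairExp_eq (i j : Fin t) (ψ : EuclideanSpace ℂ ((Fin t → Bits n) × R))
    {p q : Fin n → Fin 4} (hp : p ≠ 0) (hq : q ≠ 0) :
    cliffordPairExp i j ψ p = cliffordPairExp i j ψ q := by
  obtain ⟨r, h1, h2⟩ := exists_stringSign_eq_neg_one hp hq
  rw [cliffordPairExp_eq_of_anticommute i j ψ h1, cliffordPairExp_eq_of_anticommute i j ψ h2]

theorem cliffordPairExp_zero (i j : Fin t) (ψ : EuclideanSpace ℂ ((Fin t → Bits n) × R)) :
    cliffordPairExp i j ψ 0 = ‖ψ‖ ^ 2 := by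
  simp [cliffordPairExp, pauliString_zero, pairExp_one, norm_lift_tensorPow]

theorem sum_cliffordPairExp_le {i j : Fin t} (hij : i ≠ j)
    (ψ : EuclideanSpace ℂ ((Fin t → Bits n) × R)) :
    ∑ p, cliffordPairExp i j ψ p ≤ 2 ^ n * ‖ψ‖ ^ 2 := by
  have hi : ∀ p : Fin n → Fin 4, Integrable (fun U : QU n =>
      pairExp i j (pauliString p) (lift (tensorPow t U.1) ψ))
      (cliffordEnsemble n : Measure (QU n)) := fun p =>
    integrable_of_continuous (continuous_pairExp_lift i j _ ψ) _
  unfold cliffordPairExp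
  rw [← integral_finsetSum _ fun p _ => hi p]
  refine (integral_mono (g := fun _ => 2 ^ n * ‖ψ‖ ^ 2)
    (integrable_finsetSum _ fun p _ => hi p) (integrable_const _) fun U => ?_).trans ?_
  · exact (sum_pairExp_pauliString_le hij _).trans_eq (by rw [norm_lift_tensorPow])
  · simp

/-- The `d² - 1` nontrivial strings share one average `x`, the identity contributes `1`, and the
total is at most `d`. -/
theorem cliffordPairExp_le {i j : Fin t} (hij : i ≠ j)
    {ψ : EuclideanSpace ℂ ((Fin t → Bits n) × R)} (hψ : ‖ψ‖ = 1) {q : Fin n → Fin 4} (hq : q ≠ 0) :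
    cliffordPairExp i j ψ q ≤ 1 / 2 ^ n := by
  have h := sum_cliffordPairExp_le hij ψ
  rw [← Finset.add_sum_erase _ _ (Finset.mem_univ 0), cliffordPairExp_zero,
    Finset.sum_congr rfl fun p hp => cliffordPairExp_eq i j ψ (Finset.ne_of_mem_erase hp) hq,
    Finset.sum_const, Finset.card_erase_of_mem (Finset.mem_univ _), Finset.card_univ,
    nsmul_eq_mul, Nat.cast_sub Fintype.card_pos, Fintype.card_fun, Fintype.card_fin,
    Fintype.card_fin, hψ] at h
  -- Ensures `d > 1`, so that the factor `d - 1` can be cancelled below.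
  have hn : n ≠ 0 := by
    rintro rfl
    exact hq (Subsingleton.elim _ _)
  have hd : (1 : ℝ) < 2 ^ n := one_lt_pow₀ (by norm_num) hn
  have h4 : ((4 ^ n : ℕ) : ℝ) = (2 : ℝ) ^ n * 2 ^ n := by
    push_cast
    rw [← mul_pow]
    norm_num
  rw [h4] at h
  push_cast at h
  set d : ℝ := 2 ^ n
  set x := cliffordPairExp i j ψ q
  -- This is `1 + (d² - 1) x ≤ d` in factored form.
  have h' : (d - 1) * (x * (d + 1) - 1) ≤ 0 := by nlinarith
  have h'' : x * (d + 1) ≤ 1 := by nlinarith [nonpos_of_mul_nonpos_right h' (by linarith)]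
  have h3 : x ≤ 1 / (d + 1) := by rwa [le_div_iff₀ (by linarith)]
  exact h3.trans (one_div_le_one_div_of_le (by linarith) (by linarith))

/-- Among the `2^n` strings of `Z`s the trivial one contributes `1` and every other at most
`2^{-n}`, in total at most `2`. -/
theorem integral_collWeight_le {i j : Fin t} (hij : i ≠ j)
    {ψ : EuclideanSpace ℂ ((Fin t → Bits n) × R)} (hψ : ‖ψ‖ = 1) :
    ∫ U, collWeight i j (lift (tensorPow t U.1) ψ) ∂(cliffordEnsemble n : Measure (QU n)) ≤
      2 / 2 ^ n := by
  have hd : (0 : ℝ) < 2 ^ n := by positivity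
  have h1 : 2 ^ n * ∫ U, collWeight i j (lift (tensorPow t U.1) ψ)
      ∂(cliffordEnsemble n : Measure (QU n)) = ∑ z, cliffordPairExp i j ψ (zString z) := by
    unfold cliffordPairExp
    rw [← integral_const_mul, ← integral_finsetSum _ fun z _ =>
      integrable_of_continuous (continuous_pairExp_lift i j _ ψ) _]
    simp only [sum_pairExp_zString hij]
  have h2 : ∑ z : Bits n, cliffordPairExp i j ψ (zString z) ≤ 2 := by
    rw [← Finset.add_sum_erase _ _ (Finset.mem_univ 0), (zString_eq_zero_iff _).2 rfl,
      cliffordPairExp_zero, hψ]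
    have h3 : ∑ z ∈ Finset.univ.erase (0 : Bits n), cliffordPairExp i j ψ (zString z) ≤
        ∑ z ∈ Finset.univ.erase (0 : Bits n), 1 / 2 ^ n :=
      Finset.sum_le_sum fun z hz => cliffordPairExp_le hij hψ
        (mt (zString_eq_zero_iff z).1 (Finset.ne_of_mem_erase hz))
    have h4 : ∑ z ∈ Finset.univ.erase (0 : Bits n), (1 : ℝ) / 2 ^ n ≤
        ∑ z : Bits n, (1 : ℝ) / 2 ^ n :=
      Finset.sum_le_sum_of_subset_of_nonneg (Finset.erase_subset _ _) fun _ _ _ => by positivity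
    have h5 : ∑ z : Bits n, (1 : ℝ) / 2 ^ n = 1 := by
      rw [Finset.sum_const, Finset.card_univ, Fintype.card_fun, Fintype.card_fin, Fintype.card_fin]
      simp
    linarith
  rw [le_div_iff₀ hd, mul_comm, h1]
  exact h2

end

/-! ### Counting strings, stabilizers and random signs -/

section Counting

variable {ι : Type*} [Fintype ι] [DecidableEq ι]

/-- The stabilizer has order `∏ m_w!`, where `m_w` is the multiplicity of the letter `w`; prefixing
`v` raises `m_v` by one. -/
theorem card_stabilizer_cons (t : ℕ) (v : ι) (z : Fin t → ι) :
    Fintype.card {τ : Equiv.Perm (Fin (t + 1)) // (Fin.cons v z : Fin (t + 1) → ι) ∘ τ = Fin.cons v z} =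
      (Fintype.card {k // z k = v} + 1) * Fintype.card {τ : Equiv.Perm (Fin t) // z ∘ τ = z} := by
  have hc : ∀ w, Fintype.card {k // (Fin.cons v z : Fin (t + 1) → ι) k = w} =
      (if v = w then 1 else 0) + Fintype.card {k // z k = w} := fun w => by
    simp only [Fintype.card_subtype, Finset.card_filter, Fin.sum_univ_succ, Fin.cons_zero,
      Fin.cons_succ]
  rw [DomMulAct.stabilizer_card, DomMulAct.stabilizer_card,
    ← Finset.mul_prod_erase _ _ (Finset.mem_univ v),
    ← Finset.mul_prod_erase Finset.univ (fun i => (Fintype.card {k // z k = i}).factorial)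
      (Finset.mem_univ v), hc, if_pos rfl, add_comm 1, Nat.factorial_succ, mul_assoc]
  congr 2
  refine Finset.prod_congr rfl fun w hw => ?_
  rw [hc, if_neg (Finset.ne_of_mem_erase hw).symm, zero_add]

/-- In the induction, summing over the new letter produces `∑_v (m_v + 1) = t + d`, the next factor
of the rising factorial. -/
theorem sum_card_stabilizer (t : ℕ) :
    ∑ z : Fin t → ι, Fintype.card {τ : Equiv.Perm (Fin t) // z ∘ τ = z} =
      (Fintype.card ι).ascFactorial t := by
  induction t with
  | zero =>
    rw [Fintype.sum_unique, Nat.ascFactorial_zero, Fintype.card_eq_one_iff]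
    exact ⟨⟨1, rfl⟩, fun _ => Subsingleton.elim _ _⟩
  | succ t ih =>
    rw [← Equiv.sum_comp (Fin.consEquiv fun _ => ι), Fintype.sum_prod_type, Finset.sum_comm,
      Nat.ascFactorial_succ, ← ih, Finset.mul_sum]
    refine Finset.sum_congr rfl fun z _ => ?_
    have h : ∑ v, Fintype.card {k // z k = v} = t := by
      rw [← Fintype.card_sigma, Fintype.card_congr (Equiv.sigmaFiberEquiv z), Fintype.card_fin]
    refine (Finset.sum_congr rfl fun v _ => card_stabilizer_cons t v z).trans ?_
    rw [← Finset.sum_mul, Finset.sum_add_distrib, h, Finset.sum_const, Finset.card_univ,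
      smul_eq_mul, mul_one, add_comm t]

theorem card_stabilizer_of_injective {t : ℕ} {z : Fin t → ι} (hz : z.Injective) :
    Fintype.card {τ : Equiv.Perm (Fin t) // z ∘ τ = z} = 1 :=
  Fintype.card_eq_one_iff.2 ⟨⟨1, rfl⟩, fun τ => Subtype.ext <| Equiv.ext fun k =>
    hz (congrFun τ.2 k)⟩

theorem card_injective (t : ℕ) :
    (Finset.univ.filter fun z : Fin t → ι => z.Injective).card = (Fintype.card ι).descFactorial t := by
  rw [← Fintype.card_subtype, Fintype.card_congr (Equiv.subtypeInjectiveEquivEmbedding (Fin t) ι),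
    Fintype.card_embedding_eq, Fintype.card_fin]

theorem sum_card_stabilizer_not_injective (t : ℕ) :
    (∑ z : Fin t → ι with ¬ z.Injective,
      (Fintype.card {τ : Equiv.Perm (Fin t) // z ∘ τ = z} : ℝ)) =
      (Fintype.card ι).ascFactorial t - (Fintype.card ι).descFactorial t := by
  rw [← sum_card_stabilizer, ← card_injective, eq_sub_iff_add_eq', Finset.card_eq_sum_ones]
  push_cast
  rw [← Finset.sum_filter_add_sum_filter_not Finset.univ fun z : Fin t → ι => z.Injective]
  congr 1
  refine Finset.sum_congr rfl fun z hz => ?_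
  rw [card_stabilizer_of_injective (Finset.mem_filter.1 hz).2, Nat.cast_one]

/-- Permutations act transitively on strings of distinct letters, so a random one sends `x` to a
uniformly random such string. -/
theorem sum_perm_comp_injective {t : ℕ} (h : (Fin t → ι) → ℝ) {x : Fin t → ι} (hx : x.Injective) :
    (Fintype.card ι).descFactorial t * ∑ π : Equiv.Perm ι, h (π ∘ x) =
      (Fintype.card ι).factorial * ∑ z : Fin t → ι with z.Injective, h z := by
  have hconst : ∀ z : Fin t → ι, z.Injective →
      ∑ π : Equiv.Perm ι, h (π ∘ z) = ∑ π : Equiv.Perm ι, h (π ∘ x) := by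
    intro z hz
    obtain ⟨σ, hσ⟩ := Equiv.Perm.exists_extending_pair x z hx hz
    have : z = σ ∘ x := funext fun k => (hσ k).symm
    subst this
    exact Equiv.sum_comp (Equiv.mulRight σ) fun π : Equiv.Perm ι => h (π ∘ x)
  have h1 : ∑ z : Fin t → ι with z.Injective, ∑ π : Equiv.Perm ι, h (π ∘ z) =
      (Fintype.card ι).descFactorial t * ∑ π : Equiv.Perm ι, h (π ∘ x) := by
    rw [Finset.sum_congr rfl fun z hz => hconst z (Finset.mem_filter.1 hz).2, Finset.sum_const,
      card_injective, nsmul_eq_mul]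
  rw [← h1, Finset.sum_comm, ← Fintype.card_perm, ← Finset.card_univ, ← nsmul_eq_mul,
    ← Finset.sum_const]
  refine Finset.sum_congr rfl fun π _ => ?_
  refine Finset.sum_equiv ((Equiv.refl (Fin t)).arrowCongr π) (fun z => ?_) fun z _ => rfl
  simp only [Finset.mem_filter, Finset.mem_univ, true_and]
  exact (π.injective.of_comp_iff z).symm

/-- The phase `(-1)^{f(a_0) + f(a_1) + ⋯}` acquired by the basis vector `a`. -/
def phaseSign {t : ℕ} (f : ι → Fin 2) (a : Fin t → ι) : ℂ := ∏ k, (-1 : ℂ) ^ (f (a k) : ℕ)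

theorem phaseSign_mul_self {t : ℕ} (f : ι → Fin 2) (a : Fin t → ι) :
    phaseSign f a * phaseSign f a = 1 := by
  rw [phaseSign, ← Finset.prod_mul_distrib]
  exact Finset.prod_eq_one fun k _ => by rw [← mul_pow]; simp

theorem phaseSign_comp_perm {t : ℕ} (f : ι → Fin 2) (a : Fin t → ι) (τ : Equiv.Perm (Fin t)) :
    phaseSign f (a ∘ τ) = phaseSign f a :=
  Equiv.prod_comp τ fun k => (-1 : ℂ) ^ (f (a k) : ℕ)

theorem neg_one_pow_add_one (s : Fin 2) : (-1 : ℂ) ^ ((s + 1 : Fin 2) : ℕ) = -(-1) ^ (s : ℕ) := by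
  fin_cases s <;> simp

/-- Flipping `f` at the letter `a k` is a bijection of the functions `f`. It negates the phase of
`a`, where that letter occurs once, and fixes the phase of `b`. -/
theorem sum_phaseSign_mul_eq_zero {t : ℕ} {a b : Fin t → ι} (ha : a.Injective) {k : Fin t}
    (hk : a k ∉ Set.range b) : ∑ f : ι → Fin 2, phaseSign f a * phaseSign f b = 0 := by
  have h := Equiv.sum_comp (Equiv.addRight (Pi.single (a k) 1 : ι → Fin 2))
    fun f => phaseSign f a * phaseSign f b
  have h' : ∀ f : ι → Fin 2, phaseSign (f + Pi.single (a k) 1) a * phaseSign (f + Pi.single (a k) 1) b =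
      -(phaseSign f a * phaseSign f b) := by
    intro f
    have hb : phaseSign (f + Pi.single (a k) 1) b = phaseSign f b := by
      refine Finset.prod_congr rfl fun j _ => ?_
      rw [Pi.add_apply, Pi.single_eq_of_ne (fun e => hk ⟨j, e⟩), add_zero]
    have ha' : phaseSign (f + Pi.single (a k) 1) a = -phaseSign f a := by
      unfold phaseSign
      rw [← Finset.mul_prod_erase _ _ (Finset.mem_univ k),
        ← Finset.mul_prod_erase _ (fun k => (-1 : ℂ) ^ (f (a k) : ℕ)) (Finset.mem_univ k),
        Pi.add_apply, Pi.single_eq_same, neg_one_pow_add_one, neg_mul]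
      congr 2
      refine Finset.prod_congr rfl fun j hj => ?_
      rw [Pi.add_apply, Pi.single_eq_of_ne (fun e => Finset.ne_of_mem_erase hj (ha e)), add_zero]
    rw [ha', hb, neg_mul]
  simp only [Equiv.coe_addRight, h', Finset.sum_neg_distrib] at h
  exact self_eq_neg.1 h.symm

theorem exists_perm_of_range_subset {t : ℕ} {a b : Fin t → ι} (ha : a.Injective)
    (h : Set.range a ⊆ Set.range b) : ∃ τ : Equiv.Perm (Fin t), b ∘ τ = a := by
  choose g hg using fun k => h ⟨k, rfl⟩
  have hginj : g.Injective := fun i j hij => ha (by rw [← hg i, ← hg j, hij])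
  exact ⟨Equiv.ofBijective g (Finite.injective_iff_bijective.1 hginj), funext hg⟩

/-- Reorderings have equal phases. If `b` is not a reordering of `a`, some letter of `b` is missing
from `a` and the sum cancels. -/
theorem sum_phaseSign_mul {t : ℕ} {a b : Fin t → ι} (ha : a.Injective) (hb : b.Injective) :
    ∑ f : ι → Fin 2, phaseSign f a * phaseSign f b =
      2 ^ Fintype.card ι * ∑ τ : Equiv.Perm (Fin t), if b = a ∘ τ then 1 else 0 := by
  by_cases h : ∃ τ : Equiv.Perm (Fin t), b = a ∘ τ
  · obtain ⟨τ, rfl⟩ := h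
    have h1 : ∀ σ : Equiv.Perm (Fin t), a ∘ τ = a ∘ σ ↔ σ = τ := fun σ =>
      ⟨fun e => Equiv.ext fun k => ha (congrFun e k).symm, fun e => by rw [e]⟩
    simp [phaseSign_comp_perm, phaseSign_mul_self, h1]
  · have hk : ∃ k, b k ∉ Set.range a := by
      by_contra! hcon
      obtain ⟨τ, hτ⟩ := exists_perm_of_range_subset hb (Set.range_subset_iff.2 hcon)
      exact h ⟨τ, hτ.symm⟩
    obtain ⟨k, hk⟩ := hk
    rw [Finset.sum_congr rfl fun f _ => mul_comm _ _, sum_phaseSign_mul_eq_zero hb hk]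
    simp [not_exists.1 h]

/-- The number of ways to reorder `x` into `a`. -/
def reorderCount {t : ℕ} (x a : Fin t → ι) : ℂ :=
  ∑ τ : Equiv.Perm (Fin t), if a = x ∘ τ then 1 else 0

/-- Writes the indicator of lying in one reordering orbit as a Gram matrix indexed by `x`; the
factor `t!` counts the `x` in an orbit. -/
theorem sum_reorderCount_mul {t : ℕ} {a : Fin t → ι} (b : Fin t → ι) (ha : a.Injective) :
    ∑ x : Fin t → ι with x.Injective, reorderCount x a * reorderCount x b =
      t.factorial * reorderCount a b := by
  have h1 : ∀ τ : Equiv.Perm (Fin t), ∑ x : Fin t → ι with x.Injective,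
      (if a = x ∘ τ then 1 else 0) * reorderCount x b = reorderCount a b := by
    intro τ
    have hx : ∀ x : Fin t → ι, a = x ∘ τ ↔ x = a ∘ τ.symm := fun x =>
      ⟨fun e => by rw [e, Function.comp_assoc]; simp, fun e => by rw [e, Function.comp_assoc]; simp⟩
    simp only [hx, ite_mul, one_mul, zero_mul]
    rw [Finset.sum_ite_eq', if_pos]
    · exact (Equiv.sum_comp (Equiv.mulLeft τ) fun σ => if b = (a ∘ τ.symm) ∘ σ then (1 : ℂ) else 0).symm.trans
        (Finset.sum_congr rfl fun σ _ => by
          congr 2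
          funext k
          simp)
    · simpa using ha.comp τ.symm.injective
  have h2 : ∀ x, reorderCount x a * reorderCount x b =
      ∑ τ : Equiv.Perm (Fin t), (if a = x ∘ τ then 1 else 0) * reorderCount x b := fun x => by
    rw [reorderCount, Finset.sum_mul]
  simp only [h2]
  rw [Finset.sum_comm]
  rw [Finset.sum_congr rfl fun τ _ => h1 τ, Finset.sum_const, Finset.card_univ, Fintype.card_perm,
    Fintype.card_fin, nsmul_eq_mul]

end Counting

/-! ### Orbit vectors and the average over random signs -/

section Orbit

variable {ι R : Type*} [Fintype ι] [DecidableEq ι] [Fintype R] {t : ℕ}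

/-- Mixing a family of vectors by a unitary matrix preserves `∑ |g z⟩⟨g z|`. -/
theorem qform_sum_of_unitary {κ μ : Type*} [Fintype κ] [DecidableEq κ] [Fintype μ] [DecidableEq μ]
    (W : Matrix κ κ ℂ) {T : Matrix μ μ ℂ} (hT : T ∈ Matrix.unitaryGroup μ ℂ)
    (g : μ → EuclideanSpace ℂ κ) :
    ∑ z, qform W (∑ y, T y z • g y) = ∑ z, qform W (g z) := by
  have hT' : ∀ x y, ∑ z, T y z * star (T x z) = if y = x then 1 else 0 := fun x y => by
    have := congrFun (congrFun (Matrix.mem_unitaryGroup_iff.1 hT) y) x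
    simpa [Matrix.mul_apply, Matrix.one_apply] using this
  simp only [qform_eq_inner, map_sum, map_smul, sum_inner, inner_sum, inner_smul_left,
    inner_smul_right, ← Complex.re_sum, Finset.mul_sum]
  congr 1
  rw [Finset.sum_comm]
  refine Finset.sum_congr rfl fun y _ => ?_
  rw [Finset.sum_comm]
  have h : ∀ x, ∑ z, T y z * (starRingEnd ℂ (T x z) *
      inner ℂ (g x) (Matrix.toEuclideanLin W (g y))) =
      (if y = x then 1 else 0) * inner ℂ (g x) (Matrix.toEuclideanLin W (g y)) := fun x => by
    rw [← hT', Finset.sum_mul]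
    simp only [mul_assoc, RCLike.star_def]
  rw [Finset.sum_congr rfl fun x _ => h x]
  simp

/-- Absorbs `V` into the form, so that the sign average need only be computed with no operator in
front. -/
theorem exists_qform_lift (W : Matrix ((Fin t → ι) × R) ((Fin t → ι) × R) ℂ)
    (V : Matrix (Fin t → ι) (Fin t → ι) ℂ) :
    ∃ K : Matrix ((Fin t → ι) × R) ((Fin t → ι) × R) ℂ, ∀ φ, qform W (lift V φ) = qform K φ := by
  classical
  let e : (Fin t → ι) × R → EuclideanSpace ℂ ((Fin t → ι) × R) := fun p => EuclideanSpace.single p 1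
  have he : ∀ φ : EuclideanSpace ℂ ((Fin t → ι) × R), φ = ∑ p, φ p • e p := fun φ => by
    ext p
    simp [e, Pi.single_apply]
  refine ⟨Matrix.of fun p q => inner ℂ (lift V (e p)) (Matrix.toEuclideanLin W (lift V (e q))),
    fun φ => ?_⟩
  rw [qform_eq_inner]
  conv_lhs => rw [he φ]
  simp only [map_sum, map_smul, sum_inner, inner_sum, inner_smul_left, inner_smul_right, qform,
    Matrix.of_apply, Finset.mul_sum]
  congr 1
  rw [Finset.sum_comm]
  refine Finset.sum_congr rfl fun p _ => Finset.sum_congr rfl fun q _ => by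
    rw [RCLike.star_def]; ring

/-- The sum over all reorderings `τ` of `|z ∘ τ⟩ ⊗ φ_{x ∘ τ}`, where `φ_a` is the `a`-th block of
`φ`. -/
def orbitVec (φ : EuclideanSpace ℂ ((Fin t → ι) × R)) (x z : Fin t → ι) :
    EuclideanSpace ℂ ((Fin t → ι) × R) :=
  WithLp.toLp 2 fun p => ∑ τ : Equiv.Perm (Fin t), if p.1 = z ∘ τ then φ (x ∘ τ, p.2) else 0

theorem orbitVec_apply (φ : EuclideanSpace ℂ ((Fin t → ι) × R)) (x z : Fin t → ι)
    (p : (Fin t → ι) × R) : orbitVec φ x z p =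
      ∑ τ : Equiv.Perm (Fin t), if p.1 = z ∘ τ then φ (x ∘ τ, p.2) else 0 := rfl

/-- Reordering tensor factors commutes with `U^{⊗t}`, which therefore acts on the label `z` alone.
-/
theorem lift_orbitVec (U : Matrix ι ι ℂ) (φ : EuclideanSpace ℂ ((Fin t → ι) × R))
    (x z : Fin t → ι) : lift (tensorPow t U) (orbitVec φ x z) =
      ∑ y, tensorPow t U y z • orbitVec φ x y := by
  ext p
  simp only [lift_apply, orbitVec_apply, WithLp.ofLp_sum, Finset.sum_apply, WithLp.ofLp_smul,
    Pi.smul_apply, smul_eq_mul, Finset.mul_sum]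
  rw [Finset.sum_comm]
  conv_rhs => rw [Finset.sum_comm]
  refine Finset.sum_congr rfl fun τ _ => ?_
  have hx : ∀ y : Fin t → ι, p.1 = y ∘ τ ↔ y = p.1 ∘ τ.symm := fun y =>
    ⟨fun e => by rw [e, Function.comp_assoc]; simp, fun e => by rw [e, Function.comp_assoc]; simp⟩
  simp only [hx, mul_ite, mul_zero, Finset.sum_ite_eq', Finset.mem_univ, if_true]
  congr 1
  simp only [tensorPow, Matrix.of_apply, Function.comp_apply]
  rw [← Equiv.prod_comp τ fun k => U (p.1 (τ.symm k)) (z k)]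
  simp

/-- The exact invariance behind the theorem; it requires all `z`, including those with repeated
letters. -/
theorem sum_qform_lift_orbitVec (W : Matrix ((Fin t → ι) × R) ((Fin t → ι) × R) ℂ)
    [DecidableEq R] (U : Matrix.unitaryGroup ι ℂ) (φ : EuclideanSpace ℂ ((Fin t → ι) × R)) (x : Fin t → ι) :
    ∑ z, qform W (lift (tensorPow t U.1) (orbitVec φ x z)) = ∑ z, qform W (orbitVec φ x z) := by
  simp only [lift_orbitVec]
  exact qform_sum_of_unitary W (tensorPow_mem_unitaryGroup t U) _

/-- The set of such `τ` is empty or a coset of the stabilizer. -/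
theorem card_reorder_le (a z : Fin t → ι) :
    (Finset.univ.filter fun τ : Equiv.Perm (Fin t) => a = z ∘ τ).card ≤
      Fintype.card {τ : Equiv.Perm (Fin t) // z ∘ τ = z} := by
  rcases (Finset.univ.filter fun τ : Equiv.Perm (Fin t) => a = z ∘ τ).eq_empty_or_nonempty with h | ⟨τ₀, h⟩
  · simp [h]
  · have h0 := (Finset.mem_filter.1 h).2
    rw [Fintype.card_subtype]
    refine Finset.card_le_card_of_injOn (fun τ => τ * τ₀⁻¹) (fun τ hτ => ?_) fun τ _ σ _ e => mul_right_cancel e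
    have h1 := (Finset.mem_filter.1 hτ).2
    simp only [Finset.coe_filter, Finset.mem_univ, true_and, Set.mem_ofPred_eq, Equiv.Perm.coe_mul, ← Function.comp_assoc,
      ← h1]
    rw [h0, Function.comp_assoc]
    rw [← Equiv.Perm.coe_mul, mul_inv_cancel, Equiv.Perm.coe_one, Function.comp_id]

/-- Cauchy–Schwarz: at each basis string at most `|Stab z|` terms are nonzero. -/
theorem norm_orbitVec_sq_le (φ : EuclideanSpace ℂ ((Fin t → ι) × R)) (x z : Fin t → ι) :
    ‖orbitVec φ x z‖ ^ 2 ≤ Fintype.card {τ : Equiv.Perm (Fin t) // z ∘ τ = z} *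
      ∑ τ : Equiv.Perm (Fin t), ∑ r, ‖φ (x ∘ τ, r)‖ ^ 2 := by
  have h1 : ∀ a r, ‖orbitVec φ x z (a, r)‖ ^ 2 ≤
      Fintype.card {τ : Equiv.Perm (Fin t) // z ∘ τ = z} *
        ∑ τ : Equiv.Perm (Fin t), if a = z ∘ τ then ‖φ (x ∘ τ, r)‖ ^ 2 else 0 := by
    intro a r
    rw [orbitVec_apply, ← Finset.sum_filter, ← Finset.sum_filter]
    refine (pow_le_pow_left₀ (norm_nonneg _) (norm_sum_le _ _) 2).trans
      (sq_sum_le_card_mul_sum_sq.trans ?_)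
    refine mul_le_mul_of_nonneg_right ?_ (Finset.sum_nonneg fun _ _ => sq_nonneg _)
    exact_mod_cast card_reorder_le a z
  rw [EuclideanSpace.norm_sq_eq, Fintype.sum_prod_type]
  refine (Finset.sum_le_sum fun a _ => Finset.sum_le_sum fun r _ => h1 a r).trans_eq ?_
  simp only [← Finset.mul_sum]
  congr 1
  rw [Finset.sum_comm]
  conv_rhs => rw [Finset.sum_comm]
  refine Finset.sum_congr rfl fun r _ => ?_
  rw [Finset.sum_comm]
  simp

theorem sum_norm_orbitVec_sq_le (φ : EuclideanSpace ℂ ((Fin t → ι) × R)) :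
    ∑ x : Fin t → ι with x.Injective, ∑ z : Fin t → ι with ¬ z.Injective, ‖orbitVec φ x z‖ ^ 2 ≤
      ((Fintype.card ι).ascFactorial t - (Fintype.card ι).descFactorial t) *
        (t.factorial * ‖φ‖ ^ 2) := by
  have h1 : ∀ x, ∑ z : Fin t → ι with ¬ z.Injective, ‖orbitVec φ x z‖ ^ 2 ≤
      ((Fintype.card ι).ascFactorial t - (Fintype.card ι).descFactorial t) *
        ∑ τ : Equiv.Perm (Fin t), ∑ r, ‖φ (x ∘ τ, r)‖ ^ 2 := fun x => by
    rw [← sum_card_stabilizer_not_injective, Finset.sum_mul]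
    exact Finset.sum_le_sum fun z _ => norm_orbitVec_sq_le φ x z
  have hpos : (0 : ℝ) ≤ (Fintype.card ι).ascFactorial t - (Fintype.card ι).descFactorial t := by
    rw [← sum_card_stabilizer_not_injective]
    positivity
  refine (Finset.sum_le_sum fun x _ => h1 x).trans ?_
  rw [← Finset.mul_sum]
  refine mul_le_mul_of_nonneg_left ?_ hpos
  -- Once `x` runs over all strings, each `τ` only reindexes the sum and contributes `‖φ‖²`.
  refine (Finset.sum_le_sum_of_subset_of_nonneg (Finset.filter_subset _ _) fun _ _ _ =>
    by positivity).trans_eq ?_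
  rw [Finset.sum_comm, EuclideanSpace.norm_sq_eq, Fintype.sum_prod_type]
  have h2 : ∀ τ : Equiv.Perm (Fin t), ∑ x : Fin t → ι, ∑ r, ‖φ (x ∘ τ, r)‖ ^ 2 =
      ∑ x, ∑ r, ‖φ (x, r)‖ ^ 2 := fun τ =>
    Equiv.sum_comp (τ.symm.arrowCongr (Equiv.refl ι)) fun a => ∑ r, ‖φ (a, r)‖ ^ 2
  rw [Finset.sum_congr rfl fun τ _ => h2 τ, Finset.sum_const, Finset.card_univ, Fintype.card_perm,
    Fintype.card_fin, nsmul_eq_mul]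

/-- The phase operator applied to `φ`. -/
def phaseVec (f : ι → Fin 2) (φ : EuclideanSpace ℂ ((Fin t → ι) × R)) :
    EuclideanSpace ℂ ((Fin t → ι) × R) :=
  WithLp.toLp 2 fun p => phaseSign f p.1 * φ p

theorem star_phaseSign (f : ι → Fin 2) (a : Fin t → ι) : star (phaseSign f a) = phaseSign f a := by
  simp [phaseSign]

/-- Averaged over signs, only entries between reorderings survive, and the Gram identity
`sum_reorderCount_mul` regroups them by orbit. The vector `orbitVec φ x x` is the part of `φ` on the
orbit of `x`. -/
theorem sum_qform_phaseVec (K : Matrix ((Fin t → ι) × R) ((Fin t → ι) × R) ℂ)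
    {φ : EuclideanSpace ℂ ((Fin t → ι) × R)} (hφ : ∀ a r, ¬ a.Injective → φ (a, r) = 0) :
    t.factorial * ∑ f : ι → Fin 2, qform K (phaseVec f φ) =
      2 ^ Fintype.card ι * ∑ x : Fin t → ι with x.Injective, qform K (orbitVec φ x x) := by
  have hv : ∀ x p, orbitVec φ x x p = reorderCount x p.1 * φ p := fun x p => by
    rw [orbitVec_apply, reorderCount, Finset.sum_mul]
    refine Finset.sum_congr rfl fun τ _ => ?_
    by_cases h : p.1 = x ∘ τ
    · rw [if_pos h, if_pos h, one_mul, ← h]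
    · rw [if_neg h, if_neg h, zero_mul]
  have hs : ∀ x a : Fin t → ι, star (reorderCount x a) = reorderCount x a := fun x a => by
    simp [reorderCount]
  have hl : (t.factorial : ℂ) * ∑ f : ι → Fin 2, ∑ p, ∑ q,
        star (phaseVec f φ p) * K p q * phaseVec f φ q =
      2 ^ Fintype.card ι * ∑ x : Fin t → ι with x.Injective, ∑ p, ∑ q,
        star (orbitVec φ x x p) * K p q * orbitVec φ x x q := by
    rw [Finset.sum_comm, Finset.mul_sum]
    conv_rhs => rw [Finset.sum_comm, Finset.mul_sum]
    refine Finset.sum_congr rfl fun p _ => ?_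
    rw [Finset.sum_comm, Finset.mul_sum]
    conv_rhs => rw [Finset.sum_comm, Finset.mul_sum]
    refine Finset.sum_congr rfl fun q _ => ?_
    by_cases hp : p.1.Injective
    · by_cases hq : q.1.Injective
      · have e1 : ∀ f : ι → Fin 2, star (phaseVec f φ p) * K p q * phaseVec f φ q =
            (phaseSign f p.1 * phaseSign f q.1) * (star (φ p) * K p q * φ q) := fun f => by
          simp only [phaseVec, star_mul', star_phaseSign]
          ring
        have e2 : ∀ x, star (orbitVec φ x x p) * K p q * orbitVec φ x x q =
            (reorderCount x p.1 * reorderCount x q.1) * (star (φ p) * K p q * φ q) := fun x => by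
          simp only [hv, star_mul', hs]
          ring
        simp only [e1, e2]
        rw [← Finset.sum_mul, ← Finset.sum_mul, sum_phaseSign_mul hp hq, sum_reorderCount_mul _ hp,
          reorderCount]
        ring
      · have : φ q = 0 := hφ q.1 q.2 hq
        simp [phaseVec, hv, this]
    · have : φ p = 0 := hφ p.1 p.2 hp
      simp [phaseVec, hv, this]
  have := congrArg Complex.re hl
  simp only [qform, ← Complex.re_sum]
  have c1 : (t.factorial : ℂ) = ((t.factorial : ℝ) : ℂ) := by push_cast; rfl
  have c2 : ((2 : ℂ) ^ Fintype.card ι) = (((2 : ℝ) ^ Fintype.card ι : ℝ) : ℂ) := by push_cast; rfl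
  rwa [c1, c2, Complex.re_ofReal_mul, Complex.re_ofReal_mul] at this

end Orbit

/-! ### Averages over the ensembles and Haar invariance -/

section Integrals

variable {n : ℕ}

theorem integral_permEnsemble (f : QU n → ℝ) (hf : Continuous f) :
    ∫ U, f U ∂(permEnsemble n : Measure (QU n)) =
      ((Fintype.card (Bits n)).factorial : ℝ)⁻¹ * ∑ π, f (permUnitary π) := by
  let _ : MeasurableSpace (Equiv.Perm (Bits n)) := ⊤
  have h : (permEnsemble n : Measure (QU n)) =
      (PMF.uniformOfFintype (Equiv.Perm (Bits n))).toMeasure.map permUnitary :=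
    (PMF.toMeasure_map _ _ measurable_from_top).symm
  rw [h, integral_map measurable_from_top.aemeasurable hf.aestronglyMeasurable,
    PMF.integral_eq_sum, Finset.mul_sum]
  simp [Fintype.card_perm]

theorem integral_phaseEnsemble (f : QU n → ℝ) (hf : Continuous f) :
    ∫ U, f U ∂(phaseEnsemble n : Measure (QU n)) =
      ((2 : ℝ) ^ Fintype.card (Bits n))⁻¹ * ∑ g, f (phaseUnitary g) := by
  let _ : MeasurableSpace (Bits n → Fin 2) := ⊤
  have h : (phaseEnsemble n : Measure (QU n)) =
      (PMF.uniformOfFintype (Bits n → Fin 2)).toMeasure.map phaseUnitary :=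
    (PMF.toMeasure_map _ _ measurable_from_top).symm
  rw [h, integral_map measurable_from_top.aemeasurable hf.aestronglyMeasurable,
    PMF.integral_eq_sum, Finset.mul_sum]
  simp

theorem continuous_integral_mul {f : QU n → ℝ} (hf : Continuous f) (ν : Measure (QU n))
    [IsFiniteMeasure ν] : Continuous fun V => ∫ U, f (V * U) ∂ν := by
  have h : Continuous (Function.uncurry fun V U : QU n => f (V * U)) :=
    hf.comp (continuous_fst.mul continuous_snd)
  simpa using continuous_parametric_integral_of_continuous (μ := ν) h isCompact_univ

/-- The average of `f` over the unitaries `V P F C` with `P` and `F` random. -/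
def pfAverage (f : QU n → ℝ) (V C : QU n) : ℝ :=
  ((Fintype.card (Bits n)).factorial : ℝ)⁻¹ * ∑ π, ((2 : ℝ) ^ Fintype.card (Bits n))⁻¹ *
    ∑ g, f (V * (permUnitary π * (phaseUnitary g * C)))

theorem integral_pfcEnsemble (f : QU n → ℝ) (hf : Continuous f) :
    ∫ U, f U ∂(pfcEnsemble n : Measure (QU n)) =
      ∫ C, pfAverage f 1 C ∂(cliffordEnsemble n : Measure (QU n)) := by
  have hcont : ∀ V : QU n, Continuous fun C => f (V * C) := fun V => by fun_prop
  have h1 : ∀ V : QU n, ∫ U, f (V * U)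
      ∂((phaseEnsemble n : Measure (QU n)) ∗ₘ (cliffordEnsemble n : Measure (QU n))) =
      ((2 : ℝ) ^ Fintype.card (Bits n))⁻¹ * ∑ g, ∫ C, f (V * (phaseUnitary g * C))
        ∂(cliffordEnsemble n : Measure (QU n)) := fun V => by
    rw [integral_mconv (integrable_of_continuous (hcont V) _), integral_phaseEnsemble]
    exact continuous_integral_mul (hcont V) _
  have h2 : ∫ U, f U ∂(pfcEnsemble n : Measure (QU n)) = ∫ P, ∫ U, f (P * U)
      ∂((phaseEnsemble n : Measure (QU n)) ∗ₘ (cliffordEnsemble n : Measure (QU n)))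
      ∂(permEnsemble n : Measure (QU n)) :=
    integral_mconv (integrable_of_continuous hf (pfcEnsemble n : Measure (QU n)))
  have hc : ∀ π g, Continuous fun C => f (permUnitary π * (phaseUnitary g * C)) :=
    fun π g => by fun_prop
  rw [h2, integral_permEnsemble]
  · simp only [h1, pfAverage, one_mul]
    rw [integral_const_mul, integral_finsetSum]
    · congr 1
      refine Finset.sum_congr rfl fun π _ => ?_
      rw [integral_const_mul, integral_finsetSum]
      exact fun g _ => integrable_of_continuous (hc π g) _
    · refine fun π _ => integrable_of_continuous ?_ _
      exact continuous_const.mul (continuous_finsetSum _ fun g _ => hc π g)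
  · exact continuous_integral_mul hf _

/-- Right invariance absorbs `P F C`; this gives the Haar average the same shape as the PFC average,
with `C` fixed. -/
theorem integral_haarProb_pfAverage (f : QU n → ℝ) (hf : Continuous f) (C : QU n) :
    ∫ U, pfAverage f U C ∂(haarProb (QU n) : Measure (QU n)) =
      ∫ U, f U ∂(haarProb (QU n) : Measure (QU n)) := by
  have := haarProb_isMulRightInvariant (QU n)
  have hc : ∀ π g, Continuous fun U => f (U * (permUnitary π * (phaseUnitary g * C))) :=
    fun π g => by fun_prop
  have hcard : (Fintype.card (Bits n → Fin 2) : ℝ) = 2 ^ Fintype.card (Bits n) := by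
    rw [Fintype.card_fun, Fintype.card_fin, Nat.cast_pow, Nat.cast_ofNat]
  unfold pfAverage
  rw [integral_const_mul, integral_finsetSum]
  · have h : ∀ π, ∫ U, ((2 : ℝ) ^ Fintype.card (Bits n))⁻¹ *
        ∑ g, f (U * (permUnitary π * (phaseUnitary g * C))) ∂(haarProb (QU n) : Measure (QU n)) =
        ∫ U, f U ∂(haarProb (QU n) : Measure (QU n)) := fun π => by
      rw [integral_const_mul, integral_finsetSum]
      · rw [Finset.sum_congr rfl fun g _ => integral_mul_right_eq_self f _, Finset.sum_const,
          Finset.card_univ, nsmul_eq_mul, hcard, inv_mul_cancel_left₀ (by positivity)]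
      · exact fun g _ => integrable_of_continuous (hc π g) _
    rw [Finset.sum_congr rfl fun π _ => h π, Finset.sum_const, Finset.card_univ,
      Fintype.card_perm, nsmul_eq_mul, inv_mul_cancel_left₀ (by positivity)]
  · refine fun π _ => integrable_of_continuous ?_ _
    exact continuous_const.mul (continuous_finsetSum _ fun g _ => hc π g)

/-- Reduces the comparison with Haar measure to a bound for each fixed `U` and `C`, where only `P`
and `F` are random. -/
theorem integral_pfcEnsemble_sub_le {f : QU n → ℝ} (hf : Continuous f) {b : QU n → ℝ}
    (hb : Continuous b) (h : ∀ U C, pfAverage f 1 C - pfAverage f U C ≤ b C) :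
    ∫ U, f U ∂(pfcEnsemble n : Measure (QU n)) - ∫ U, f U ∂(haarProb (QU n) : Measure (QU n)) ≤
      ∫ C, b C ∂(cliffordEnsemble n : Measure (QU n)) := by
  have hc1 : Continuous fun C => pfAverage f 1 C := by unfold pfAverage; fun_prop
  have hc2 : ∀ C, Continuous fun U => pfAverage f U C := fun C => by unfold pfAverage; fun_prop
  have h1 : ∀ C, pfAverage f 1 C - ∫ U, f U ∂(haarProb (QU n) : Measure (QU n)) ≤ b C := by
    intro C
    have e : pfAverage f 1 C - ∫ U, f U ∂(haarProb (QU n) : Measure (QU n)) =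
        ∫ U, (pfAverage f 1 C - pfAverage f U C) ∂(haarProb (QU n) : Measure (QU n)) := by
      rw [integral_sub (integrable_const _) (integrable_of_continuous (hc2 C) _),
        integral_haarProb_pfAverage f hf]
      simp
    rw [e]
    refine (integral_mono (g := fun _ => b C) ?_ (integrable_const _) fun U => h U C).trans ?_
    · exact (integrable_const _).sub (integrable_of_continuous (hc2 C) _)
    · simp
  have e : ∫ U, f U ∂(pfcEnsemble n : Measure (QU n)) -
      ∫ U, f U ∂(haarProb (QU n) : Measure (QU n)) =
      ∫ C, (pfAverage f 1 C - ∫ U, f U ∂(haarProb (QU n) : Measure (QU n)))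
        ∂(cliffordEnsemble n : Measure (QU n)) := by
    rw [integral_sub (integrable_of_continuous hc1 _) (integrable_const _), integral_pfcEnsemble f hf]
    simp
  rw [e]
  exact integral_mono ((integrable_of_continuous hc1 _).sub (integrable_const _))
    (integrable_of_continuous hb _) h1

end Integrals

/-! ### The comparison for fixed `U` and `C` -/

section Pointwise

variable {n t : ℕ} {R : Type*} [Fintype R] [DecidableEq R]

theorem lift_permUnitary_orbitVec (π : Equiv.Perm (Bits n))
    (φ : EuclideanSpace ℂ ((Fin t → Bits n) × R)) (x z : Fin t → Bits n) :
    lift (tensorPow t (permUnitary π).1) (orbitVec φ x z) = orbitVec φ x (π ∘ z) := by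
  rw [lift_orbitVec, Finset.sum_eq_single (π ∘ z)]
  · simp [tensorPow, permUnitary]
  · intro y _ hy
    obtain ⟨k, hk⟩ := Function.ne_iff.1 hy
    have : tensorPow t (permUnitary π).1 y z = 0 :=
      Finset.prod_eq_zero (Finset.mem_univ k) (if_neg hk)
    rw [this, zero_smul]
  · simp

theorem lift_phaseUnitary (f : Bits n → Fin 2) (φ : EuclideanSpace ℂ ((Fin t → Bits n) × R)) :
    lift (tensorPow t (phaseUnitary f).1) φ = phaseVec f φ := by
  ext p
  rw [lift_apply, Finset.sum_eq_single p.1]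
  · simp [tensorPow, phaseUnitary, phaseVec, phaseSign]
  · intro b _ hb
    obtain ⟨k, hk⟩ := Function.ne_iff.1 hb
    have : tensorPow t (phaseUnitary f).1 p.1 b = 0 :=
      Finset.prod_eq_zero (Finset.mem_univ k) (Matrix.diagonal_apply_ne _ hk.symm)
    rw [this, zero_mul]
  · simp

/-- The function `U ↦ ⟨ψ| U^{⊗t †} W U^{⊗t} |ψ⟩` on the unitary group. -/
def twirlForm (W : Matrix ((Fin t → Bits n) × R) ((Fin t → Bits n) × R) ℂ)
    (ψ : EuclideanSpace ℂ ((Fin t → Bits n) × R)) (U : QU n) : ℝ :=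
  qform W (lift (tensorPow t U.1) ψ)

theorem twirlForm_mul (W : Matrix ((Fin t → Bits n) × R) ((Fin t → Bits n) × R) ℂ)
    (ψ : EuclideanSpace ℂ ((Fin t → Bits n) × R)) (U V : QU n) :
    twirlForm W ψ (U * V) = twirlForm W (lift (tensorPow t V.1) ψ) U := by
  rw [twirlForm, twirlForm, ← lift_mul, ← tensorPow_mul]
  rfl

theorem continuous_twirlForm (W : Matrix ((Fin t → Bits n) × R) ((Fin t → Bits n) × R) ℂ)
    (ψ : EuclideanSpace ℂ ((Fin t → Bits n) × R)) : Continuous (twirlForm W ψ) :=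
  (continuous_qform W).comp (continuous_lift_tensorPow ψ)

/-- For fixed `π` the signs leave the vectors `orbitVec φ x (π ∘ x)`; averaging over `π` then makes
`π ∘ x` uniform among distinct-letter strings, whatever `x` is. -/
theorem pfAverage_twirlForm_of_injective
    (W : Matrix ((Fin t → Bits n) × R) ((Fin t → Bits n) × R) ℂ)
    {φ : EuclideanSpace ℂ ((Fin t → Bits n) × R)} (hφ : ∀ a r, ¬ a.Injective → φ (a, r) = 0)
    (V : QU n) (ht : t ≤ Fintype.card (Bits n)) :
    pfAverage (twirlForm W φ) V 1 =
      ((t.factorial : ℝ) * (Fintype.card (Bits n)).descFactorial t)⁻¹ *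
        ∑ x : Fin t → Bits n with x.Injective, ∑ z : Fin t → Bits n with z.Injective,
          qform W (lift (tensorPow t V.1) (orbitVec φ x z)) := by
  have hdesc : ((Fintype.card (Bits n)).descFactorial t : ℝ) ≠ 0 := by
    exact_mod_cast (Nat.pos_of_ne_zero (mt Nat.descFactorial_eq_zero_iff_lt.1 (not_lt.2 ht))).ne'
  have h1 : ∀ π : Equiv.Perm (Bits n), ((2 : ℝ) ^ Fintype.card (Bits n))⁻¹ *
      ∑ g, twirlForm W φ (V * (permUnitary π * (phaseUnitary g * 1))) =
      (t.factorial : ℝ)⁻¹ * ∑ x : Fin t → Bits n with x.Injective,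
        qform W (lift (tensorPow t V.1) (orbitVec φ x (π ∘ x))) := fun π => by
    obtain ⟨K, hK⟩ := exists_qform_lift W (tensorPow t (V * permUnitary π).1)
    have hL : ∀ g, twirlForm W φ (V * (permUnitary π * (phaseUnitary g * 1))) =
        qform K (phaseVec g φ) := fun g => by
      rw [mul_one, ← mul_assoc, twirlForm_mul, lift_phaseUnitary, ← hK]
      rfl
    have hR : ∀ x, qform W (lift (tensorPow t V.1) (orbitVec φ x (π ∘ x))) =
        qform K (orbitVec φ x x) := fun x => by
      rw [← hK, ← lift_permUnitary_orbitVec, ← lift_mul, ← tensorPow_mul]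
      rfl
    simp only [hL, hR]
    have := sum_qform_phaseVec K hφ
    field_simp
    linarith
  unfold pfAverage
  simp only [h1]
  rw [← Finset.mul_sum, Finset.sum_comm, mul_left_comm, Finset.mul_sum, mul_inv, mul_assoc]
  congr 1
  rw [Finset.mul_sum]
  refine Finset.sum_congr rfl fun x hx => ?_
  have := sum_perm_comp_injective (fun z => qform W (lift (tensorPow t V.1) (orbitVec φ x z)))
    (Finset.mem_filter.1 hx).2
  field_simp
  linarith

/-- The relative excess `d (d+1) ⋯ (d+t-1) / (d (d-1) ⋯ (d-t+1)) - 1`. -/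
def factorialDefect (d t : ℕ) : ℝ := (d.ascFactorial t - d.descFactorial t) / d.descFactorial t

/-- Completed to all `z`, the two sums agree. Only the `z` with repeated letters remain in the
difference, each costing at most `2 ‖orbitVec φ x z‖²`. -/
theorem pfAverage_twirlForm_sub_le_of_injective
    {W : Matrix ((Fin t → Bits n) × R) ((Fin t → Bits n) × R) ℂ}
    (hW : W ∈ Matrix.unitaryGroup ((Fin t → Bits n) × R) ℂ)
    {φ : EuclideanSpace ℂ ((Fin t → Bits n) × R)} (hφ : ∀ a r, ¬ a.Injective → φ (a, r) = 0)
    (U : QU n) (ht : t ≤ Fintype.card (Bits n)) :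
    pfAverage (twirlForm W φ) 1 1 - pfAverage (twirlForm W φ) U 1 ≤
      2 * factorialDefect (Fintype.card (Bits n)) t * ‖φ‖ ^ 2 := by
  have hdesc : (0 : ℝ) < (Fintype.card (Bits n)).descFactorial t := by
    exact_mod_cast (Nat.pos_of_ne_zero (mt Nat.descFactorial_eq_zero_iff_lt.1 (not_lt.2 ht)))
  have hsplit : ∀ V : QU n, ∀ x : Fin t → Bits n,
      ∑ z : Fin t → Bits n with z.Injective, qform W (lift (tensorPow t V.1) (orbitVec φ x z)) =
      ∑ z, qform W (orbitVec φ x z) - ∑ z : Fin t → Bits n with ¬ z.Injective,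
        qform W (lift (tensorPow t V.1) (orbitVec φ x z)) := fun V x => by
    rw [← sum_qform_lift_orbitVec W V φ x, eq_sub_iff_add_eq,
      Finset.sum_filter_add_sum_filter_not]
  rw [pfAverage_twirlForm_of_injective W hφ _ ht, pfAverage_twirlForm_of_injective W hφ _ ht,
    ← mul_sub, ← Finset.sum_sub_distrib]
  have hb : ∑ x : Fin t → Bits n with x.Injective,
      (∑ z : Fin t → Bits n with z.Injective,
        qform W (lift (tensorPow t (1 : QU n).1) (orbitVec φ x z)) -
      ∑ z : Fin t → Bits n with z.Injective, qform W (lift (tensorPow t U.1) (orbitVec φ x z))) ≤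
      ∑ x : Fin t → Bits n with x.Injective, ∑ z : Fin t → Bits n with ¬ z.Injective,
        2 * ‖orbitVec φ x z‖ ^ 2 := by
    refine Finset.sum_le_sum fun x _ => ?_
    rw [hsplit, hsplit, sub_sub_sub_cancel_left, ← Finset.sum_sub_distrib]
    refine Finset.sum_le_sum fun z _ => ?_
    have h1 := abs_qform_le hW (lift (tensorPow t (1 : QU n).1) (orbitVec φ x z))
    have h2 := abs_qform_le hW (lift (tensorPow t U.1) (orbitVec φ x z))
    rw [norm_lift_tensorPow] at h1 h2
    have := abs_le.1 h1
    have := abs_le.1 h2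
    linarith
  refine (mul_le_mul_of_nonneg_left hb (by positivity)).trans ?_
  simp only [← Finset.mul_sum]
  refine (mul_le_mul_of_nonneg_left (mul_le_mul_of_nonneg_left (sum_norm_orbitVec_sq_le φ)
    zero_le_two) (by positivity)).trans_eq ?_
  rw [factorialDefect]
  field_simp

/-- The projection onto the span of the strings with distinct letters. -/
def injProj (φ : EuclideanSpace ℂ ((Fin t → Bits n) × R)) :
    EuclideanSpace ℂ ((Fin t → Bits n) × R) :=
  WithLp.toLp 2 fun p => if p.1.Injective then φ p else 0

theorem norm_injProj_le (φ : EuclideanSpace ℂ ((Fin t → Bits n) × R)) : ‖injProj φ‖ ≤ ‖φ‖ := by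
  rw [EuclideanSpace.norm_eq, EuclideanSpace.norm_eq]
  refine Real.sqrt_le_sqrt (Finset.sum_le_sum fun p _ => ?_)
  simp only [injProj]
  split_ifs
  · exact le_rfl
  · simp

/-- Union bound over ordered pairs of positions. -/
theorem norm_sub_injProj_sq_le (φ : EuclideanSpace ℂ ((Fin t → Bits n) × R)) :
    ‖φ - injProj φ‖ ^ 2 ≤ ∑ i : Fin t, ∑ j ∈ Finset.univ.erase i, collWeight i j φ := by
  simp only [collWeight]
  rw [EuclideanSpace.norm_sq_eq, Finset.sum_congr rfl fun i _ => Finset.sum_comm, Finset.sum_comm]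
  refine Finset.sum_le_sum fun p _ => ?_
  have hnn : ∀ i j : Fin t, (0 : ℝ) ≤ if p.1 i = p.1 j then ‖φ p‖ ^ 2 else 0 := fun i j => by
    split_ifs <;> positivity
  by_cases hp : p.1.Injective
  · simp only [injProj, WithLp.ofLp_sub, Pi.sub_apply, if_pos hp, sub_self, norm_zero]
    rw [zero_pow two_ne_zero]
    exact Finset.sum_nonneg fun i _ => Finset.sum_nonneg fun j _ => hnn i j
  · simp only [injProj, WithLp.ofLp_sub, Pi.sub_apply, if_neg hp, sub_zero]
    obtain ⟨i, j, hij, hne⟩ := Function.not_injective_iff.1 hp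
    calc ‖φ p‖ ^ 2 = if p.1 i = p.1 j then ‖φ p‖ ^ 2 else 0 := by rw [if_pos hij]
      _ ≤ ∑ j ∈ Finset.univ.erase i, if p.1 i = p.1 j then ‖φ p‖ ^ 2 else 0 :=
        Finset.single_le_sum (f := fun j => if p.1 i = p.1 j then ‖φ p‖ ^ 2 else 0)
          (fun j _ => hnn i j) (Finset.mem_erase.2 ⟨hne.symm, Finset.mem_univ j⟩)
      _ ≤ _ := Finset.single_le_sum
          (f := fun i => ∑ j ∈ Finset.univ.erase i, if p.1 i = p.1 j then ‖φ p‖ ^ 2 else 0)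
          (fun i _ => Finset.sum_nonneg fun j _ => hnn i j) (Finset.mem_univ i)

theorem pfAverage_le_add {f g : QU n → ℝ} {δ : ℝ} (h : ∀ U, f U ≤ g U + δ) (V C : QU n) :
    pfAverage f V C ≤ pfAverage g V C + δ := by
  have h1 : pfAverage (fun _ => δ) V C = δ := by
    simp only [pfAverage, Finset.sum_const, Finset.card_univ, Fintype.card_fun, Fintype.card_fin,
      Fintype.card_perm, nsmul_eq_mul]
    push_cast
    rw [inv_mul_cancel_left₀ (by positivity), inv_mul_cancel_left₀ (by positivity)]
  have h2 : pfAverage (fun U => g U + δ) V C = pfAverage g V C + pfAverage (fun _ => δ) V C := by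
    simp only [pfAverage, Finset.sum_add_distrib, mul_add]
  rw [← h1, ← h2]
  unfold pfAverage
  gcongr
  exact h _

theorem abs_twirlForm_sub_le {W : Matrix ((Fin t → Bits n) × R) ((Fin t → Bits n) × R) ℂ}
    (hW : W ∈ Matrix.unitaryGroup ((Fin t → Bits n) × R) ℂ)
    {φ : EuclideanSpace ℂ ((Fin t → Bits n) × R)} (hφ : ‖φ‖ = 1) (U : QU n) :
    |twirlForm W φ U - twirlForm W (injProj φ) U| ≤ 2 * ‖φ - injProj φ‖ := by
  refine (abs_qform_sub_le hW _ _).trans ?_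
  rw [← map_sub, norm_lift_tensorPow, norm_lift_tensorPow, norm_lift_tensorPow]
  have := norm_injProj_le φ
  gcongr
  linarith

theorem factorialDefect_nonneg (d t : ℕ) : 0 ≤ factorialDefect d t := by
  have h : (∑ z : Fin t → Fin d with ¬ z.Injective,
      (Fintype.card {τ : Equiv.Perm (Fin t) // z ∘ τ = z} : ℝ)) =
      d.ascFactorial t - d.descFactorial t := by
    simpa using sum_card_stabilizer_not_injective (ι := Fin d) t
  rw [factorialDefect, ← h]
  positivity

/-- Replacing `φ` by its projection costs `2 ‖φ - injProj φ‖` in each of the two averages. -/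
theorem pfAverage_twirlForm_sub_le {W : Matrix ((Fin t → Bits n) × R) ((Fin t → Bits n) × R) ℂ}
    (hW : W ∈ Matrix.unitaryGroup ((Fin t → Bits n) × R) ℂ)
    {φ : EuclideanSpace ℂ ((Fin t → Bits n) × R)} (hφ : ‖φ‖ = 1) (U : QU n)
    (ht : t ≤ Fintype.card (Bits n)) :
    pfAverage (twirlForm W φ) 1 1 - pfAverage (twirlForm W φ) U 1 ≤
      4 * ‖φ - injProj φ‖ + 2 * factorialDefect (Fintype.card (Bits n)) t := by
  have h1 := pfAverage_le_add (f := twirlForm W φ) (g := twirlForm W (injProj φ))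
    (δ := 2 * ‖φ - injProj φ‖)
    (fun V => by linarith [(abs_le.1 (abs_twirlForm_sub_le hW hφ V)).2]) 1 1
  have h2 := pfAverage_le_add (f := twirlForm W (injProj φ)) (g := twirlForm W φ)
    (δ := 2 * ‖φ - injProj φ‖)
    (fun V => by linarith [(abs_le.1 (abs_twirlForm_sub_le hW hφ V)).1]) U 1
  have h3 := pfAverage_twirlForm_sub_le_of_injective hW (φ := injProj φ)
    (fun a r ha => if_neg ha) U ht
  have h4 : ‖injProj φ‖ ^ 2 ≤ 1 := by
    have := norm_injProj_le φ
    rw [hφ] at this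
    exact pow_le_one₀ (norm_nonneg _) this
  have h5 := factorialDefect_nonneg (Fintype.card (Bits n)) t
  nlinarith

theorem pfAverage_twirlForm_eq (W : Matrix ((Fin t → Bits n) × R) ((Fin t → Bits n) × R) ℂ)
    (ψ : EuclideanSpace ℂ ((Fin t → Bits n) × R)) (V C : QU n) :
    pfAverage (twirlForm W ψ) V C = pfAverage (twirlForm W (lift (tensorPow t C.1) ψ)) V 1 := by
  unfold pfAverage
  simp only [mul_one, ← twirlForm_mul, mul_assoc]

/-- Each ratio `(d + k) / (d - k)` is at most `1 + 4k/d ≤ exp (4t/d)`, so the product is at most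
`exp (4t²/d)`; then `exp x ≤ 1 + 2x` on `[0, 1]`. -/
theorem factorialDefect_le {d t : ℕ} (hd : 16 * t ^ 2 ≤ d) (ht : 0 < t) :
    factorialDefect d t ≤ 8 * ((t : ℝ) ^ 2 / d) := by
  have htd : t ≤ d := by nlinarith
  have hd0 : (0 : ℝ) < d := by exact_mod_cast ht.trans_le htd
  have hdesc : (0 : ℝ) < d.descFactorial t := by
    exact_mod_cast (Nat.pos_of_ne_zero (mt Nat.descFactorial_eq_zero_iff_lt.1 (not_lt.2 htd)))
  have h1 : (d.ascFactorial t : ℝ) ≤ d.descFactorial t * Real.exp (4 * t / d) ^ t := by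
    rw [Nat.ascFactorial_eq_prod_range, Nat.descFactorial_eq_prod_range]
    rw [Nat.cast_prod, Nat.cast_prod, ← Finset.card_range t, ← Finset.prod_const,
      Finset.card_range, ← Finset.prod_mul_distrib]
    refine Finset.prod_le_prod (fun k _ => by positivity) fun k hk => ?_
    have hkt : k < t := Finset.mem_range.1 hk
    have hk2 : 2 * (k : ℝ) ≤ d := by
      have : 2 * k ≤ d := by nlinarith
      exact_mod_cast this
    have hkt' : (k : ℝ) ≤ t := by exact_mod_cast hkt.le
    have hk0 : (0 : ℝ) ≤ k := k.cast_nonneg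
    rw [Nat.cast_sub (by omega), Nat.cast_add]
    have he : 1 + 4 * (k : ℝ) / d ≤ Real.exp (4 * t / d) := by
      rw [add_comm]
      refine (Real.add_one_le_exp _).trans (Real.exp_le_exp.2 ?_)
      gcongr
    refine le_trans ?_ (mul_le_mul_of_nonneg_left he (by linarith))
    -- The right side is nonnegative because `2k ≤ d`.
    have e : ((d : ℝ) - k) * (1 + 4 * k / d) - (d + k) = 2 * k * (d - 2 * k) / d := by
      field_simp
      ring
    have : 0 ≤ 2 * (k : ℝ) * (d - 2 * k) / d := by
      have : (0 : ℝ) ≤ d - 2 * k := by linarith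
      positivity
    linarith
  have hx : 4 * ((t : ℝ) ^ 2 / d) ≤ 1 := by
    have : (16 : ℝ) * t ^ 2 ≤ d := by exact_mod_cast hd
    rw [← mul_div_assoc, div_le_one hd0]
    nlinarith
  have h2 : Real.exp (4 * t / d) ^ t ≤ 1 + 8 * ((t : ℝ) ^ 2 / d) := by
    rw [← Real.exp_nat_mul, show (t : ℝ) * (4 * t / d) = 4 * ((t : ℝ) ^ 2 / d) by ring]
    have h0 : (0 : ℝ) ≤ 4 * ((t : ℝ) ^ 2 / d) := by positivity
    have := (abs_le.1 (Real.abs_exp_sub_one_le (abs_le.2 ⟨by linarith, hx⟩))).2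
    rw [abs_of_nonneg h0] at this
    linarith
  rw [factorialDefect, div_le_iff₀ hdesc]
  nlinarith

end Pointwise

/-! ### Integration over the Clifford group and the final constant -/

section Main

variable {n t : ℕ}

theorem continuous_injProj {R : Type*} [Fintype R] :
    Continuous (injProj : EuclideanSpace ℂ ((Fin t → Bits n) × R) → _) := by
  refine (PiLp.continuous_toLp 2 _).comp (continuous_pi fun p => ?_)
  by_cases hp : p.1.Injective
  · simp only [if_pos hp]; fun_prop
  · simp only [if_neg hp]; fun_prop

theorem continuous_collWeight {R : Type*} [Fintype R] (i j : Fin t) :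
    Continuous (collWeight i j : EuclideanSpace ℂ ((Fin t → Bits n) × R) → ℝ) := by
  unfold collWeight
  refine continuous_finsetSum _ fun p _ => ?_
  split_ifs <;> fun_prop

/-- A random Clifford unitary moves almost all the weight of `ψ` to strings with distinct
letters. -/
theorem integral_norm_sub_injProj_sq_le {R : Type*} [Fintype R] [DecidableEq R]
    {ψ : EuclideanSpace ℂ ((Fin t → Bits n) × R)} (hψ : ‖ψ‖ = 1) :
    ∫ C, ‖lift (tensorPow t C.1) ψ - injProj (lift (tensorPow t C.1) ψ)‖ ^ 2
      ∂(cliffordEnsemble n : Measure (QU n)) ≤ 2 * ((t : ℝ) ^ 2 / 2 ^ n) := by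
  have hL := continuous_lift_tensorPow (ι := Bits n) ψ
  have hc : ∀ i j, Continuous fun C : QU n => collWeight i j (lift (tensorPow t C.1) ψ) :=
    fun i j => (continuous_collWeight i j).comp hL
  have h1 : ∫ C, ‖lift (tensorPow t C.1) ψ - injProj (lift (tensorPow t C.1) ψ)‖ ^ 2
      ∂(cliffordEnsemble n : Measure (QU n)) ≤
      ∫ C, ∑ i : Fin t, ∑ j ∈ Finset.univ.erase i, collWeight i j (lift (tensorPow t C.1) ψ)
        ∂(cliffordEnsemble n : Measure (QU n)) :=
    integral_mono (integrable_of_continuous ((hL.sub (continuous_injProj.comp hL)).norm.pow 2) _)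
      (integrable_of_continuous (continuous_finsetSum _ fun i _ =>
        continuous_finsetSum _ fun j _ => hc i j) _) fun C => norm_sub_injProj_sq_le _
  refine h1.trans ?_
  rw [integral_finsetSum _ fun i _ => integrable_of_continuous
    (continuous_finsetSum _ fun j _ => hc i j) _]
  have h2 : ∀ i : Fin t, ∫ C, ∑ j ∈ Finset.univ.erase i,
      collWeight i j (lift (tensorPow t C.1) ψ) ∂(cliffordEnsemble n : Measure (QU n)) ≤
      t * (2 / 2 ^ n) := fun i => by
    rw [integral_finsetSum _ fun j _ => integrable_of_continuous (hc i j) _]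
    refine (Finset.sum_le_sum fun j hj =>
      integral_collWeight_le (Finset.ne_of_mem_erase hj).symm hψ).trans ?_
    rw [Finset.sum_const, nsmul_eq_mul]
    gcongr
    exact (Finset.card_erase_le).trans_eq (by simp)
  refine (Finset.sum_le_sum fun i _ => h2 i).trans_eq ?_
  simp
  ring

theorem integral_twirlForm_sub_le_two {R : Type*} [Fintype R] [DecidableEq R]
    {W : Matrix ((Fin t → Bits n) × R) ((Fin t → Bits n) × R) ℂ}
    (hW : W ∈ Matrix.unitaryGroup ((Fin t → Bits n) × R) ℂ)
    {ψ : EuclideanSpace ℂ ((Fin t → Bits n) × R)} (hψ : ‖ψ‖ = 1)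
    (ν μ : ProbabilityMeasure (QU n)) :
    ∫ U, twirlForm W ψ U ∂(ν : Measure (QU n)) - ∫ U, twirlForm W ψ U ∂(μ : Measure (QU n)) ≤ 2 := by
  have hb : ∀ U, |twirlForm W ψ U| ≤ 1 := fun U => by
    have := abs_qform_le hW (lift (tensorPow t U.1) ψ)
    rwa [norm_lift_tensorPow, hψ, one_pow] at this
  have hi : ∀ ν : ProbabilityMeasure (QU n), |∫ U, twirlForm W ψ U ∂(ν : Measure (QU n))| ≤ 1 :=
    fun ν => by
      have := norm_integral_le_of_norm_le_const (μ := (ν : Measure (QU n))) (C := 1)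
        (f := twirlForm W ψ) (ae_of_all _ hb)
      simpa using this
  have h1 := (abs_le.1 (hi ν)).2
  have h2 := (abs_le.1 (hi μ)).1
  linarith

theorem integral_twirlForm_sub_le {R : Type*} [Fintype R] [DecidableEq R]
    {W : Matrix ((Fin t → Bits n) × R) ((Fin t → Bits n) × R) ℂ}
    (hW : W ∈ Matrix.unitaryGroup ((Fin t → Bits n) × R) ℂ)
    {ψ : EuclideanSpace ℂ ((Fin t → Bits n) × R)} (hψ : ‖ψ‖ = 1) :
    ∫ U, twirlForm W ψ U ∂(pfcEnsemble n : Measure (QU n)) -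
      ∫ U, twirlForm W ψ U ∂(haarProb (QU n) : Measure (QU n)) ≤
      10 * ((t : ℝ) / Real.sqrt (2 ^ n)) := by
  have hd : (0 : ℝ) < 2 ^ n := by positivity
  rcases Nat.eq_zero_or_pos t with rfl | ht
  -- For `t = 0` the integrand is constant; the main argument divides by `s`, which would vanish.
  · have h : ∀ U : QU n, twirlForm W ψ U = twirlForm W ψ 1 := fun U => by
      have : tensorPow 0 U.1 = tensorPow 0 (1 : QU n).1 := by
        ext a b
        simp [tensorPow]
      rw [twirlForm, this]
      rfl
    simp [h]
  set s : ℝ := (t : ℝ) / Real.sqrt (2 ^ n) with hs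
  have hs0 : 0 < s := by positivity
  have hs2 : s ^ 2 = (t : ℝ) ^ 2 / 2 ^ n := by rw [hs, div_pow, Real.sq_sqrt hd.le]
  -- Above `1/4` the trivial bound `2` is already below `10 s`; below it, `16 t² ≤ d` as the defect
  -- estimate requires.
  by_cases hs4 : 1 / 4 < s
  · exact (integral_twirlForm_sub_le_two hW hψ _ _).trans (by linarith)
  rw [not_lt] at hs4
  have hcard : Fintype.card (Bits n) = 2 ^ n := by
    rw [Fintype.card_fun, Fintype.card_fin, Fintype.card_fin]
  have h16 : 16 * t ^ 2 ≤ 2 ^ n := by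
    have : (t : ℝ) ^ 2 / 2 ^ n ≤ 1 / 16 := by rw [← hs2]; nlinarith
    rw [div_le_iff₀ hd] at this
    have : (16 : ℝ) * t ^ 2 ≤ 2 ^ n := by linarith
    exact_mod_cast this
  have htd : t ≤ Fintype.card (Bits n) := by rw [hcard]; nlinarith
  have hδ : factorialDefect (Fintype.card (Bits n)) t ≤ 8 * s ^ 2 := by
    rw [hcard, hs2]
    have := factorialDefect_le h16 ht
    push_cast at this
    exact this
  have hL := continuous_lift_tensorPow (ι := Bits n) ψ
  have hnorm : Continuous fun C : QU n =>
      ‖lift (tensorPow t C.1) ψ - injProj (lift (tensorPow t C.1) ψ)‖ ^ 2 :=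
    (hL.sub (continuous_injProj.comp hL)).norm.pow 2
  -- The bound uses the squared distance, whose mean is at most `2 s²`. Integration gives `4s + 2s +
  -- 16s²`, at most `10 s` because `s ≤ 1/4`.
  have hmain := integral_pfcEnsemble_sub_le (continuous_twirlForm W ψ)
    (b := fun C => 2 / s * ‖lift (tensorPow t C.1) ψ - injProj (lift (tensorPow t C.1) ψ)‖ ^ 2 +
      (2 * s + 16 * s ^ 2)) ((continuous_const.mul hnorm).add continuous_const) ?_
  · refine hmain.trans ?_
    rw [integral_add ((integrable_of_continuous hnorm _).const_mul _) (integrable_const _),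
      integral_const_mul]
    have h1 := integral_norm_sub_injProj_sq_le (t := t) hψ
    rw [← hs2] at h1
    have h2 := mul_le_mul_of_nonneg_left h1 (show 0 ≤ 2 / s by positivity)
    have h3 : 2 / s * (2 * s ^ 2) = 4 * s := by field_simp; ring
    rw [h3] at h2
    simp only [integral_const, probReal_univ, one_smul]
    nlinarith
  · intro U C
    rw [pfAverage_twirlForm_eq W ψ 1 C, pfAverage_twirlForm_eq W ψ U C]
    have hC : ‖lift (tensorPow t C.1) ψ‖ = 1 := by rw [norm_lift_tensorPow, hψ]
    refine (pfAverage_twirlForm_sub_le hW hC U htd).trans ?_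
    set x := ‖lift (tensorPow t C.1) ψ - injProj (lift (tensorPow t C.1) ψ)‖
    -- Weighted AM–GM, balanced at `x = s`, replaces Jensen's inequality for the square root.
    have h1 : 4 * x ≤ 2 / s * x ^ 2 + 2 * s := by
      have : 2 / s * x ^ 2 + 2 * s - 4 * x = 2 / s * (x - s) ^ 2 := by field_simp; ring
      have h0 : 0 ≤ 2 / s * (x - s) ^ 2 := by positivity
      linarith
    linarith

end Main

end PFC

end

/-- There is a universal constant `c` such that, for all `n` and `t`, the PFC ensemble in
dimension `d = 2^n` is a diamond `c t / √d`-approximate `t`-design. -/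
theorem mainTheorem1 :
    ∃ c : ℝ, 0 < c ∧ ∀ n t : ℕ,
      PFC.IsDiamondApproxDesign (PFC.pfcEnsemble n) (c * ((t : ℝ) / Real.sqrt ((2 : ℝ) ^ n))) t :=
  ⟨10, by norm_num, fun _ _ => PFC.isDiamondApproxDesign_of_qform fun _ hψ _ hW =>
    PFC.integral_twirlForm_sub_le hW hψ⟩
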